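/- \textbf{Conventions.} All graphs are finite and simple. A \emph{signed graph} $(G,\sigma)$ is a graph $G$ with a signature $\sigma:E(G)\to\{+1,-1\}$. A \emph{coloring} of $(G,\sigma)$ is a map $c:V(G)\to\mathbb{Z}$ with $c(u)\neq\sigma(uv)\,c(v)$ for every edge $uv\in E(G)$. A \emph{list assignment} $L$ assigns to each vertex $v$ a finite set $L(v)\subseteq\mathbb{Z}$, and a \emph{proper $L$-coloring} is a coloring $c$ with $c(v)\in L(v)$ for every $v\in V(G)$. A \emph{near-triangulation} is a $2$-connected plane graph in which every bounded face is a triangle; its \emph{outer cycle} is the cycle bounding the unbounded face. Plane graphs are taken up to homeomorphism, through their combinatorial embeddings: a connected plane graph with at least one edge is a connected graph with a rotation system (a cyclic order of the edges at each vertex) whose faces (the orbits of face tracing) satisfy $|V|-|E|+|F|=2$, with one face designated as the unbounded one. \textbf{Theorem (Main Extension Theorem).} Let $(G,\sigma)$ be a signed near-triangulation with outer cycle $C\colon v_1v_2\cdots v_pv_1$ ($p\ge 3$), and let $L$ be a list assignment for $G$. Suppose that \begin{enumerate} \item[(i)] $c_1\in L(v_1)$ and $c_2\in L(v_2)$ are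 such that $c_1\neq\sigma(v_1v_2)\,c_2$; \item[(ii)] $|L(v)|\ge 3$ for every $v\in V(C)\setminus\{v_1,v_2\}$; \item[(iii)] $|L(v)|\ge 5$ for every $v\in V(G)\setminus V(C)$. \end{enumerate} Then there is a proper $L$-coloring $c$ of $(G,\sigma)$ with $c(v_1)=c_1$ and $c(v_2)=c_2$. -/

import Mathlib

/-! Graphs are finite and simple (`SimpleGraph V` with `V` finite). -/

/-- A graph is `2`-connected if it has more than two vertices and stays connected after the
deletion of any fewer than two vertices. -/
def SimpleGraph.IsTwoConnected {V : Type*} (G : SimpleGraph V) : Prop :=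
  2 < Nat.card V ∧ ∀ X : Set V, X.ncard < 2 → (G.induce Xᶜ).Connected

/-! ### Plane graphs

A connected plane graph is represented by its combinatorial embedding (rotation system):
for every vertex, the cyclic order in which the edges leave it.  A *dart* is an edge together
with one of its two directions. -/

/-- A rotation system on `G`: the permutation `next` sends a dart leaving a vertex `u` to the
following dart leaving `u` (in clockwise order, say); at every vertex the darts
leaving it form a single cycle. -/
structure RotationSystem {V : Type*} (G : SimpleGraph V) where
  next : Equiv.Perm G.Dart
  next_fst : ∀ d : G.Dart, (next d).fst = d.fst
  sameCycle_of_fst_eq : ∀ d e : G.Dart, d.fst = e.fst → next.SameCycle d e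

namespace RotationSystem

variable {V : Type*} {G : SimpleGraph V} (R : RotationSystem G)

/-- Reversal of darts, as a permutation. -/
def reverse (G : SimpleGraph V) : Equiv.Perm G.Dart where
  toFun := SimpleGraph.Dart.symm
  invFun := SimpleGraph.Dart.symm
  left_inv := SimpleGraph.Dart.symm_symm
  right_inv := SimpleGraph.Dart.symm_symm

/-- The face-tracing permutation: after traversing the dart `(u, w)`, continue along the dart
that follows `(w, u)` in the rotation at `w`. -/
def faceStep : Equiv.Perm G.Dart := (reverse G).trans R.next

/-- The faces of the embedding: the orbits of face tracing. -/
def Face : Type _ := Quotient (Equiv.Perm.SameCycle.setoid R.faceStep)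

/-- The face that is traced by a dart. -/
def faceOf (d : G.Dart) : R.Face := Quotient.mk (Equiv.Perm.SameCycle.setoid R.faceStep) d

/-- The darts on the boundary walk of a face. -/
def faceDarts (f : R.Face) : Set G.Dart := {d | R.faceOf d = f}

/-- The edges on the boundary of a face. -/
def faceEdges (f : R.Face) : Set (Sym2 V) := SimpleGraph.Dart.edge '' R.faceDarts f

/-- A face is a triangle if its boundary walk has length three (in a simple graph, a closed
facial walk of length three runs around a triangle). -/
def IsTriangle (f : R.Face) : Prop := (R.faceDarts f).ncard = 3

/-- The rotation system embeds `G` in the sphere: `G` is connected and the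
number of vertices minus the number of edges plus the number of faces is `2` (Euler genus zero).
It is used only for graphs with at least one edge. -/
def IsPlane : Prop :=
  G.Connected ∧ Nat.card V + Nat.card R.Face = Nat.card G.edgeSet + 2

/-- A near-triangulation: a `2`-connected plane graph, with one face `outer` singled out as the
unbounded one, in which every other (that is, every bounded) face is a triangle. -/
structure IsNearTriangulation (outer : R.Face) : Prop where
  twoConnected : G.IsTwoConnected
  plane : R.IsPlane
  triangle : ∀ f : R.Face, f ≠ outer → R.IsTriangle f

/-- The closed walk `C` is a cycle of `G`, and it is the boundary of the face `f`. The cycle may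
run around the face in either direction and start at any of its vertices. -/
def IsBoundaryCycle (f : R.Face) {u : V} (C : G.Walk u u) : Prop :=
  C.IsCycle ∧ R.faceEdges f = {e | e ∈ C.edges}

end RotationSystem

/-! ### Signed graphs and their colorings -/

/-- A signature `σ : E(G) → {+1, -1}`; a signed graph is a graph with a signature. -/
abbrev SimpleGraph.Signature {V : Type*} (G : SimpleGraph V) : Type _ := G.edgeSet → ℤˣ

/-- The sign `σ(uv)`, as an integer. -/
def SimpleGraph.Signature.sign {V : Type*} {G : SimpleGraph V} (σ : G.Signature) {u v : V}
    (h : G.Adj u v) : ℤ :=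
  ((σ ⟨s(u, v), h⟩ : ℤˣ) : ℤ)

/-- `c` is a (proper) coloring of the signed graph `(G, σ)`: `c(u) ≠ σ(uv) c(v)` on every edge. -/
def SimpleGraph.Signature.IsColoring {V : Type*} {G : SimpleGraph V} (σ : G.Signature)
    (c : V → ℤ) : Prop :=
  ∀ (u v : V) (h : G.Adj u v), c u ≠ σ.sign h * c v

/-- `c` is a (proper) `L`-coloring of the signed graph `(G, σ)`. -/
def SimpleGraph.Signature.IsListColoring {V : Type*} {G : SimpleGraph V} (σ : G.Signature)
    (L : V → Finset ℤ) (c : V → ℤ) : Prop :=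
  σ.IsColoring c ∧ ∀ v, c v ∈ L v

/-! The coloring argument is Thomassen's, with signs. They do no harm, because a color at one end of
an edge still excludes a single color at the other end. Let `w` be the boundary neighbor of `v₁`
other than `v₂`, and reserve two colors for `w`, both compatible with `c₁`. The triangles at `w` are
then removed one at a time, each lying on the current boundary edge `wv` and having a third vertex
`u`. If `u` is inside, the at most two colors that the reserved ones exclude are struck from its
list; three remain, `u` joins the boundary, and the edge `uw` needs no further care. If `u` is on
the boundary, the rest falls into two pieces meeting in `u`. The piece containing `v₁v₂` is colored
first, `w` takes a reserved color that `u` permits, and the other piece is colored from the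
precolored edge `wu`. This treats a chord at `w` and the end of the fan alike.

Topology is replaced by linear algebra. A disc is a set of triangular faces, not containing the
outer one, whose boundary chain is the unit flow around a simple cycle; nothing else about its shape
is needed. Euler's formula makes every circulation the jump of a function on the faces
(`exists_jump_eq`), which takes the place of the Jordan curve theorem: the potential of a subcycle
tells the two pieces apart (`IsDisc.split`). Two chains are shown equal by noting that their
difference is a circulation carried by a path, hence zero (`eq_zero_of_support_onPath`). The
induction runs over the set of faces. -/

section PlaneDiscs

open scoped Classical

/-! ### Circulations and potentials on the faces. -/

namespace RotationSystem

variable {V : Type*} {G : SimpleGraph V} (R : RotationSystem G)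

instance [Finite V] : Finite G.Dart :=
  Finite.of_injective _ SimpleGraph.Dart.toProd_injective

instance [Finite V] : Finite R.Face :=
  inferInstanceAs (Finite (Quotient (Equiv.Perm.SameCycle.setoid R.faceStep)))

lemma faceOf_eq_iff {d e : G.Dart} : R.faceOf d = R.faceOf e ↔ R.faceStep.SameCycle d e :=
  Quotient.eq

lemma faceStep_apply (d : G.Dart) : R.faceStep d = R.next d.symm := rfl

@[simp] lemma faceOf_faceStep (d : G.Dart) : R.faceOf (R.faceStep d) = R.faceOf d := by
  rw [faceOf_eq_iff]
  exact (Equiv.Perm.SameCycle.refl _ _).apply_left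

lemma faceOf_next (d : G.Dart) : R.faceOf (R.next d) = R.faceOf d.symm := by
  rw [← R.faceOf_faceStep d.symm, faceStep_apply, SimpleGraph.Dart.symm_symm]

lemma faceStep_fst (d : G.Dart) : (R.faceStep d).fst = d.snd := by
  rw [faceStep_apply, R.next_fst]
  rfl

/-- The jump of a function on faces when an edge is crossed. -/
def jump {K : Type*} [Sub K] (h : R.Face → K) (d : G.Dart) : K :=
  h (R.faceOf d) - h (R.faceOf d.symm)

lemma jump_symm {K : Type*} [AddGroup K] (h : R.Face → K) (d : G.Dart) :
    R.jump h d.symm = - R.jump h d := by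
  simp [jump]

/-- A function on darts is balanced if its values on the darts leaving any vertex sum to zero. -/
def _root_.SimpleGraph.IsBalanced [Fintype V] {K : Type*} [AddCommMonoid K]
    (z : G.Dart → K) : Prop :=
  ∀ v, ∑ d : G.Dart, (if d.fst = v then z d else 0) = 0

/-- Turning about `v` permutes the darts leaving it and carries the face behind each dart to the
face of the next one, so the two halves of the sum are reindexings of each other. -/
lemma isBalanced_jump [Fintype V] {K : Type*} [AddCommGroup K] (h : R.Face → K) :
    SimpleGraph.IsBalanced (R.jump h) := by
  intro v
  have key : ∑ d : G.Dart, (if d.fst = v then h (R.faceOf d) else 0)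
      = ∑ d : G.Dart, (if d.fst = v then h (R.faceOf d.symm) else 0) := by
    rw [← Equiv.sum_comp R.next]
    refine Finset.sum_congr rfl fun d _ => ?_
    rw [R.next_fst, R.faceOf_next]
  calc _ = ∑ d : G.Dart, ((if d.fst = v then h (R.faceOf d) else 0)
      - (if d.fst = v then h (R.faceOf d.symm) else 0)) := by
        refine Finset.sum_congr rfl fun d _ => ?_
        split_ifs <;> simp [jump]
    _ = 0 := by rw [Finset.sum_sub_distrib, key, sub_self]

/-- A vertex around which `P` does not change from face to face sees only one value of `P`. -/
lemma eq_of_forall_fst_eq {α : Type*} [Finite V] (h : R.Face → α) {v : V}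
    (hv : ∀ d : G.Dart, d.fst = v → h (R.faceOf d) = h (R.faceOf d.symm))
    {d e : G.Dart} (hd : d.fst = v) (he : e.fst = v) : h (R.faceOf d) = h (R.faceOf e) := by
  obtain ⟨i, -, rfl⟩ := (R.sameCycle_of_fst_eq d e (hd.trans he.symm)).exists_pow_eq'
  clear he
  have : ∀ i : ℕ, ((R.next ^ i) d).fst = v ∧
      h (R.faceOf d) = h (R.faceOf ((R.next ^ i) d)) := by
    intro i
    induction i with
    | zero => exact ⟨hd, rfl⟩
    | succ i ih =>
      rw [pow_succ', Equiv.Perm.mul_apply, R.next_fst, R.faceOf_next, ← hv _ ih.1]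
      exact ih
  exact (this i).2

/-- The dual graph is connected. -/
lemma eq_of_forall_jump [Finite V] {α : Type*} (hG : G.Connected) (h : R.Face → α)
    (hh : ∀ d : G.Dart, h (R.faceOf d) = h (R.faceOf d.symm)) (f g : R.Face) : h f = h g := by
  obtain ⟨d, rfl⟩ := Quotient.exists_rep f
  obtain ⟨e, rfl⟩ := Quotient.exists_rep g
  change h (R.faceOf d) = h (R.faceOf e)
  have loc : ∀ {d e : G.Dart}, d.fst = e.fst → h (R.faceOf d) = h (R.faceOf e) :=
    fun {d e} hde => R.eq_of_forall_fst_eq h (fun d _ => hh d) hde rfl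
  have : ∀ {u v : V} (p : G.Walk u v) (d e : G.Dart), d.fst = u → e.fst = v →
      h (R.faceOf d) = h (R.faceOf e) := by
    intro u v p
    induction p with
    | nil => intro d e hd he; exact loc (hd.trans he.symm)
    | @cons u w v huw p ih =>
      intro d e hd he
      rw [← ih (⟨(u, w), huw⟩ : G.Dart).symm e rfl he, ← hh]
      exact loc hd
  obtain ⟨p⟩ := hG.preconnected d.fst e.fst
  exact this p d e rfl rfl

/-- Summing over darts is summing over edges both of whose darts are taken. -/
lemma sum_darts_eq_sum_edges [Fintype V] {K : Type*} [AddCommMonoid K]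
    (D : G.edgeSet → G.Dart) (hD : ∀ e, (D e).edge = e) (φ : G.Dart → K) :
    ∑ d, φ d = ∑ e, (φ (D e) + φ (D e).symm) := by
  rw [← Finset.sum_fiberwise (s := Finset.univ) (g := fun d : G.Dart =>
    (⟨d.edge, d.edge_mem⟩ : G.edgeSet))]
  refine Finset.sum_congr rfl fun e _ => ?_
  have : (Finset.univ.filter fun d : G.Dart => (⟨d.edge, d.edge_mem⟩ : G.edgeSet) = e)
      = {D e, (D e).symm} := by
    ext d
    simp only [Finset.mem_filter, Finset.mem_univ, true_and, Finset.mem_insert,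
      Finset.mem_singleton]
    rw [← SimpleGraph.dart_edge_eq_iff, hD, Subtype.ext_iff]
  rw [this, Finset.sum_pair (SimpleGraph.Dart.symm_ne _).symm]

/-- In a plane graph every circulation is the jump of a potential on the faces. -/
lemma exists_jump_eq [Fintype V] (hR : R.IsPlane) (z : G.Dart → ℚ)
    (hz : ∀ d, z d.symm = - z d) (hb : SimpleGraph.IsBalanced z) :
    ∃ h : R.Face → ℚ, ∀ d, R.jump h d = z d := by
  obtain ⟨hG, hE⟩ := hR
  have : Fintype R.Face := Fintype.ofFinite _
  have hDe : ∀ e : G.edgeSet, ∃ d : G.Dart, d.edge = e := by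
    rintro ⟨e, he⟩
    induction e with
    | h a b => exact ⟨⟨(a, b), he⟩, rfl⟩
  choose D hD using hDe
  have hcov : ∀ d : G.Dart, ∃ e, d = D e ∨ d = (D e).symm := fun d =>
    ⟨⟨d.edge, d.edge_mem⟩, (SimpleGraph.dart_edge_eq_iff _ _).1 (hD ⟨d.edge, d.edge_mem⟩).symm⟩
  -- `M` is the incidence matrix of the orientation `D`, and its kernel is the space of
  -- circulations; `A` is the coboundary from faces to edges.
  let M : Matrix V G.edgeSet ℚ := fun v e =>
    (if (D e).fst = v then 1 else 0) - (if (D e).snd = v then 1 else 0)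
  let A : (R.Face → ℚ) →ₗ[ℚ] (G.edgeSet → ℚ) :=
    { toFun := fun h e => R.jump h (D e)
      map_add' := by intro h k; ext e; simp [jump]; ring
      map_smul' := by intro a h; ext e; simp [jump]; ring }
  have mem_ker : ∀ y : G.Dart → ℚ, (∀ d, y d.symm = - y d) → SimpleGraph.IsBalanced y →
      (fun e => y (D e)) ∈ LinearMap.ker M.mulVecLin := by
    intro y hy hyb
    rw [LinearMap.mem_ker]
    ext v
    have := hyb v
    rw [sum_darts_eq_sum_edges D hD] at this
    rw [Matrix.mulVecLin_apply, Pi.zero_apply, ← this]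
    refine Finset.sum_congr rfl fun e _ => ?_
    have h2 : (D e).symm.fst = (D e).snd := rfl
    simp only [M, h2, hy]
    split_ifs <;> ring
  have hle : LinearMap.range A ≤ LinearMap.ker M.mulVecLin := by
    rintro _ ⟨h, rfl⟩
    exact mem_ker (R.jump h) (R.jump_symm h) (R.isBalanced_jump h)
  have hkA : Module.finrank ℚ (LinearMap.ker A) ≤ 1 := by
    refine finrank_le_one (⟨fun _ => 1, ?_⟩ : LinearMap.ker A) ?_
    · rw [LinearMap.mem_ker]; ext e; simp [A, jump]
    · rintro ⟨h, hh⟩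
      rw [LinearMap.mem_ker] at hh
      have hj : ∀ d, h (R.faceOf d) = h (R.faceOf d.symm) := by
        intro d
        obtain ⟨e, rfl | rfl⟩ := hcov d
        · exact sub_eq_zero.1 (congrFun hh e)
        · rw [SimpleGraph.Dart.symm_symm]
          exact (sub_eq_zero.1 (congrFun hh e)).symm
      by_cases hne : Nonempty R.Face
      · obtain ⟨f⟩ := hne
        refine ⟨h f, ?_⟩
        ext g
        simpa using R.eq_of_forall_jump hG h hj f g
      · refine ⟨0, ?_⟩
        ext g
        exact (hne ⟨g⟩).elim
  have hMT : ∀ g e, M.transpose.mulVecLin g e = g (D e).fst - g (D e).snd := by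
    intro g e
    change ∑ v, M v e * g v = _
    simp [M, sub_mul, Finset.sum_sub_distrib]
  have hkM : Module.finrank ℚ (LinearMap.ker M.transpose.mulVecLin) ≤ 1 := by
    refine finrank_le_one (⟨fun _ => 1, ?_⟩ : LinearMap.ker M.transpose.mulVecLin) ?_
    · rw [LinearMap.mem_ker]; ext e
      rw [hMT]; simp
    · rintro ⟨g, hg⟩
      rw [LinearMap.mem_ker] at hg
      have hj : ∀ e, g (D e).fst = g (D e).snd := by
        intro e
        have := congrFun hg e
        rw [hMT] at this
        exact sub_eq_zero.1 this
      have hadj : ∀ a b, G.Adj a b → g a = g b := by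
        intro a b hab
        obtain ⟨e, he | he⟩ := hcov ⟨(a, b), hab⟩
        · have := hj e
          rwa [← he] at this
        · have := hj e
          rw [← SimpleGraph.Dart.symm_symm (D e), ← he] at this
          exact this.symm
      have hwalk : ∀ {a b : V} (p : G.Walk a b), g a = g b := by
        intro a b p
        induction p with
        | nil => rfl
        | cons h p ih => exact (hadj _ _ h).trans ih
      obtain ⟨v⟩ := hG.nonempty
      refine ⟨g v, ?_⟩
      ext w
      obtain ⟨p⟩ := hG.preconnected v w
      simpa using hwalk p
  -- With both kernels of dimension at most one, the range of `A` has dimension at least `|F| - 1`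
  -- and the kernel of `M` at most `|E| - (|V| - 1)`. Euler's formula makes these bounds equal, so
  -- the inclusion `hle` is an equality.
  have e1 := LinearMap.finrank_range_add_finrank_ker A
  have e2 := LinearMap.finrank_range_add_finrank_ker M.mulVecLin
  have e3 := LinearMap.finrank_range_add_finrank_ker M.transpose.mulVecLin
  have e4 : M.transpose.rank = M.rank := Matrix.rank_transpose M
  unfold Matrix.rank at e4
  rw [Module.finrank_pi] at e1 e2 e3
  rw [Nat.card_eq_fintype_card, Nat.card_eq_fintype_card, Nat.card_eq_fintype_card] at hE
  have heq : LinearMap.range A = LinearMap.ker M.mulVecLin :=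
    Submodule.eq_of_le_of_finrank_le hle (by omega)
  obtain ⟨h, hh⟩ := heq.ge (mem_ker z hz hb)
  refine ⟨h, fun d => ?_⟩
  obtain ⟨e, rfl | rfl⟩ := hcov d
  · exact congrFun hh e
  · rw [R.jump_symm, hz]
    exact congrArg Neg.neg (congrFun hh e)

end RotationSystem

/-! ### Flows along lists of vertices. -/

namespace SimpleGraph

variable {V : Type*} {G : SimpleGraph V}

/-- The unit flow from `a` to `b`, as an antisymmetric function on darts. -/
noncomputable def unitFlow (a b : V) (d : G.Dart) : ℤ :=
  (if d.fst = a ∧ d.snd = b then 1 else 0) - (if d.fst = b ∧ d.snd = a then 1 else 0)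

/-- The unit flow along a list of vertices. -/
noncomputable def pathFlow : List V → G.Dart → ℤ
  | a :: b :: t, d => unitFlow a b d + pathFlow (b :: t) d
  | _, _ => 0

/-- The pair `e` consists of two consecutive entries of the list. -/
def OnPath : List V → Sym2 V → Prop
  | a :: b :: t, e => e = s(a, b) ∨ OnPath (b :: t) e
  | _, _ => False

@[simp] lemma pathFlow_cons_cons (a b : V) (t : List V) (d : G.Dart) :
    pathFlow (a :: b :: t) d = unitFlow a b d + pathFlow (b :: t) d := rfl

@[simp] lemma pathFlow_singleton (a : V) (d : G.Dart) : pathFlow [a] d = 0 := rfl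

@[simp] lemma onPath_cons_cons (a b : V) (t : List V) (e : Sym2 V) :
    OnPath (a :: b :: t) e ↔ e = s(a, b) ∨ OnPath (b :: t) e := Iff.rfl

@[simp] lemma not_onPath_singleton (a : V) (e : Sym2 V) : ¬ OnPath [a] e := id

lemma unitFlow_symm (a b : V) (d : G.Dart) : unitFlow a b d.symm = - unitFlow a b d := by
  simp [unitFlow, and_comm]

lemma unitFlow_swap (a b : V) (d : G.Dart) : unitFlow b a d = - unitFlow a b d := by
  simp [unitFlow]

lemma unitFlow_self_eq_one {a b : V} (d : G.Dart) (ha : d.fst = a) (hb : d.snd = b) :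
    unitFlow a b d = 1 := by
  subst ha hb
  simp [unitFlow, d.fst_ne_snd]

lemma edge_eq_of_unitFlow_ne_zero {a b : V} {d : G.Dart} (h : unitFlow a b d ≠ 0) :
    d.edge = s(a, b) := by
  rw [dart_edge_eq_mk'_iff']
  by_contra hn
  push Not at hn
  apply h
  simp only [unitFlow]
  rw [if_neg (by tauto), if_neg (by tauto), sub_zero]

lemma unitFlow_ne_zero {a b : V} {d : G.Dart} (h : d.edge = s(a, b)) : unitFlow a b d ≠ 0 := by
  rw [dart_edge_eq_mk'_iff'] at h
  obtain ⟨h1, h2⟩ | ⟨h1, h2⟩ := h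
  · rw [unitFlow_self_eq_one d h1 h2]; decide
  · rw [unitFlow_swap, unitFlow_self_eq_one d h1 h2]; decide

lemma pathFlow_symm : ∀ (l : List V) (d : G.Dart), pathFlow l d.symm = - pathFlow l d
  | [], _ => by simp [pathFlow]
  | [_], _ => by simp
  | a :: b :: t, d => by simp [unitFlow_symm, pathFlow_symm (b :: t) d]; ring

lemma pathFlow_append (p : List V) (a : V) (q : List V) (d : G.Dart) :
    pathFlow (p ++ a :: q) d = pathFlow (p ++ [a]) d + pathFlow (a :: q) d := by
  induction p with
  | nil => simp
  | cons b p ih =>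
    cases p with
    | nil => simp
    | cons c p =>
      simp only [List.cons_append, pathFlow_cons_cons] at ih ⊢
      rw [ih]; ring

lemma pathFlow_reverse (l : List V) (d : G.Dart) : pathFlow l.reverse d = - pathFlow l d := by
  induction l with
  | nil => simp [pathFlow]
  | cons a l ih =>
    cases l with
    | nil => simp
    | cons b l =>
      have : (a :: b :: l).reverse = l.reverse ++ b :: [a] := by simp
      rw [this, pathFlow_append, ← List.reverse_cons, ih]
      simp [unitFlow_swap a b]

lemma onPath_of_pathFlow_ne_zero : ∀ {l : List V} {d : G.Dart}, pathFlow l d ≠ 0 → OnPath l d.edge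
  | [], _, h => (h rfl).elim
  | [_], _, h => (h rfl).elim
  | a :: b :: t, d, h => by
    by_cases h1 : unitFlow a b d = 0
    · rw [pathFlow_cons_cons, h1, zero_add] at h
      exact Or.inr (onPath_of_pathFlow_ne_zero h)
    · exact Or.inl (edge_eq_of_unitFlow_ne_zero h1)

lemma mem_of_onPath : ∀ {l : List V} {e : Sym2 V}, OnPath l e → ∀ v ∈ e, v ∈ l
  | [], _, h => h.elim
  | [_], _, h => h.elim
  | a :: b :: t, e, h => by
    rintro v hv
    obtain rfl | h := h
    · rw [Sym2.mem_iff] at hv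
      rcases hv with rfl | rfl <;> simp
    · exact List.mem_cons_of_mem _ (mem_of_onPath h v hv)

lemma pathFlow_eq_zero_of_fst_notMem {l : List V} {d : G.Dart} (h : d.fst ∉ l) :
    pathFlow l d = 0 := by
  by_contra hne
  exact h (mem_of_onPath (onPath_of_pathFlow_ne_zero hne) _ (Sym2.mem_mk_left _ _))

lemma pathFlow_eq_zero_of_snd_notMem {l : List V} {d : G.Dart} (h : d.snd ∉ l) :
    pathFlow l d = 0 := by
  by_contra hne
  exact h (mem_of_onPath (onPath_of_pathFlow_ne_zero hne) _ (Sym2.mem_mk_right _ _))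

/-- A flow along a simple path is nonzero on every edge of the path. -/
lemma pathFlow_ne_zero : ∀ {l : List V}, l.Nodup → ∀ {d : G.Dart}, OnPath l d.edge →
    pathFlow l d ≠ 0
  | [], _, _, h => h.elim
  | [_], _, _, h => h.elim
  | a :: b :: t, hl, d, h => by
    rw [List.nodup_cons] at hl
    rw [pathFlow_cons_cons]
    rcases h with h | h
    · have hz : pathFlow (b :: t) d = 0 := by
        by_contra hne
        refine hl.1 (mem_of_onPath (onPath_of_pathFlow_ne_zero hne) a ?_)
        rw [h]; exact Sym2.mem_mk_left _ _
      rw [hz, add_zero]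
      exact unitFlow_ne_zero h
    · have hz : unitFlow a b d = 0 := by
        by_contra hne
        refine hl.1 (mem_of_onPath h a ?_)
        rw [edge_eq_of_unitFlow_ne_zero hne]; exact Sym2.mem_mk_left _ _
      rw [hz, zero_add]
      exact pathFlow_ne_zero hl.2 h

/-- The first edge is not used again when the list has at least three vertices; for two vertices the
flow would go out and back and cancel. -/
lemma pathFlow_closed_eq_one {a b : V} {t : List V} (hl : (a :: b :: t).Nodup) (ht : t ≠ [])
    {d : G.Dart} (ha : d.fst = a) (hb : d.snd = b) : pathFlow (a :: b :: t ++ [a]) d = 1 := by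
  cases t with
  | nil => exact (ht rfl).elim
  | cons c t =>
    subst ha hb
    simp only [List.cons_append, pathFlow_cons_cons]
    rw [unitFlow_self_eq_one d rfl rfl, pathFlow_eq_zero_of_snd_notMem]
    · have : unitFlow d.snd c d = 0 := by
        by_contra hne
        have h := edge_eq_of_unitFlow_ne_zero hne
        rw [dart_edge_eq_mk'_iff'] at h
        simp at hl
        rcases h with ⟨h, -⟩ | ⟨h, -⟩
        · exact d.fst_ne_snd h
        · exact hl.1.1 h
      rw [this]; rfl
    · have := d.fst_ne_snd.symm
      simp at hl ⊢
      tauto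

variable [Fintype V]

lemma sum_unitFlow {a b : V} (hab : G.Adj a b) (v : V) :
    ∑ d : G.Dart, (if d.fst = v then unitFlow a b d else 0)
      = (if a = v then 1 else 0) - (if b = v then 1 else 0) := by
  have h : ∀ (a b : V) (hab : G.Adj a b), ∑ d : G.Dart,
      (if d.fst = v then (if d.fst = a ∧ d.snd = b then (1 : ℤ) else 0) else 0)
      = if a = v then 1 else 0 := by
    intro a b hab
    rw [Finset.sum_eq_single (⟨(a, b), hab⟩ : G.Dart)]
    · simp
    · intro d _ hd
      rw [ite_eq_right_iff]
      intro _
      rw [if_neg]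
      rintro ⟨h1, h2⟩
      exact hd (Dart.ext _ _ (Prod.ext h1 h2))
    · simp
  rw [← h a b hab, ← h b a hab.symm, ← Finset.sum_sub_distrib]
  refine Finset.sum_congr rfl fun d _ => ?_
  by_cases hv : d.fst = v <;> simp [hv, unitFlow]

/-- The net outflows of the unit flows telescope, leaving only the two ends; a closed list therefore
gives a circulation. -/
lemma sum_pathFlow (v a : V) : ∀ (b : V) (l : List V), List.IsChain G.Adj (b :: (l ++ [a])) →
    ∑ d : G.Dart, (if d.fst = v then pathFlow (b :: (l ++ [a])) d else 0)
      = (if b = v then 1 else 0) - (if a = v then 1 else 0)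
  | b, [], h => by
    simp only [List.nil_append, List.isChain_cons_cons] at h
    simpa using sum_unitFlow h.1 v
  | b, c :: l, h => by
    simp only [List.cons_append, List.isChain_cons_cons] at h
    have ih := sum_pathFlow v a c l h.2
    have hs := sum_unitFlow h.1 v
    calc _ = ∑ d : G.Dart, ((if d.fst = v then unitFlow b c d else 0)
          + (if d.fst = v then pathFlow (c :: (l ++ [a])) d else 0)) := by
          refine Finset.sum_congr rfl fun d _ => ?_
          split_ifs <;> simp
      _ = _ := by rw [Finset.sum_add_distrib, ih, hs]; ring

lemma isBalanced_pathFlow_closed (a : V) (t : List V) (h : List.IsChain G.Adj (a :: t ++ [a])) :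
    IsBalanced (G := G) (pathFlow (a :: t ++ [a])) := by
  intro v
  rw [List.cons_append] at h ⊢
  rw [sum_pathFlow v a a t h, sub_self]

/-- A circulation supported on a simple path vanishes. -/
lemma eq_zero_of_support_onPath {y : G.Dart → ℤ} (hy : ∀ d, y d.symm = - y d)
    (hb : IsBalanced y) : ∀ {l : List V}, l.Nodup → (∀ d, ¬ OnPath l d.edge → y d = 0) →
    ∀ d, y d = 0
  | [], _, h, d => h d id
  | [_], _, h, d => h d id
  | a :: b :: t, hl, h, d => by
    rw [List.nodup_cons] at hl
    refine eq_zero_of_support_onPath hy hb hl.2 (fun d hd => ?_) d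
    by_cases hd2 : d.edge = s(a, b)
    · have key : ∀ e : G.Dart, e.fst = a → e.snd = b → y e = 0 := by
        intro e ha heb
        rw [← hb a, Finset.sum_eq_single e]
        · rw [if_pos ha]
        · intro e' _ hne
          rw [ite_eq_right_iff]
          intro ha'
          refine h e' ?_
          rintro (he | he)
          · rw [dart_edge_eq_mk'_iff'] at he
            rcases he with ⟨-, h2⟩ | ⟨h1, h2⟩
            · exact hne (Dart.ext _ _ (Prod.ext (ha'.trans ha.symm) (h2.trans heb.symm)))
            · exact e'.fst_ne_snd (ha'.trans h2.symm)
          · refine hl.1 (mem_of_onPath he a ?_)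
            rw [← ha']; exact Sym2.mem_mk_left _ _
        · simp
      rw [dart_edge_eq_mk'_iff'] at hd2
      rcases hd2 with ⟨h1, h2⟩ | ⟨h1, h2⟩
      · exact key d h1 h2
      · have := key d.symm h2 h1
        rw [hy] at this
        omega
    · exact h d (by simp [hd, hd2])

end SimpleGraph

lemma SimpleGraph.onPath_append {V : Type*} (p : List V) (a : V) (q : List V) (e : Sym2 V) :
    OnPath (p ++ a :: q) e ↔ OnPath (p ++ [a]) e ∨ OnPath (a :: q) e := by
  induction p with
  | nil => simp
  | cons b p ih =>
    cases p with
    | nil => simp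
    | cons c p =>
      simp only [List.cons_append, onPath_cons_cons] at ih ⊢
      rw [ih, or_assoc]

/-! ### Discs as sets of triangular faces. -/

namespace RotationSystem

open SimpleGraph

variable {V : Type*} {G : SimpleGraph V} (R : RotationSystem G)

/-- The boundary of a set of faces, as an antisymmetric function on darts. -/
noncomputable def boundary (S : Finset R.Face) : G.Dart → ℤ :=
  R.jump fun f => if f ∈ S then 1 else 0

lemma boundary_eq_zero_iff {S : Finset R.Face} {d : G.Dart} :
    R.boundary S d = 0 ↔ (R.faceOf d ∈ S ↔ R.faceOf d.symm ∈ S) := by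
  simp only [boundary, jump]
  split_ifs <;> simp_all

lemma boundary_eq_one_iff {S : Finset R.Face} {d : G.Dart} :
    R.boundary S d = 1 ↔ (R.faceOf d ∈ S ∧ R.faceOf d.symm ∉ S) := by
  simp only [boundary, jump]
  split_ifs <;> simp_all

lemma boundary_symm (S : Finset R.Face) (d : G.Dart) :
    R.boundary S d.symm = - R.boundary S d := R.jump_symm _ d

lemma boundary_erase {S : Finset R.Face} {f : R.Face} (hf : f ∈ S) (d : G.Dart) :
    R.boundary (S.erase f) d = R.boundary S d - R.boundary {f} d := by
  have : ∀ g : R.Face, (if g ∈ S.erase f then (1 : ℤ) else 0)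
      = (if g ∈ S then 1 else 0) - (if g ∈ ({f} : Finset R.Face) then 1 else 0) := by
    intro g
    by_cases hg : g = f
    · subst hg; simp [hf]
    · simp [hg]
  simp only [boundary, jump, this]
  ring

/-- The closed facial walk of `f` is `w, v, u`. -/
def IsTriangleOn (f : R.Face) (w v u : V) : Prop :=
  G.Adj w v ∧ G.Adj v u ∧ G.Adj u w ∧ ∀ e : G.Dart, R.faceOf e = f ↔
    (e.fst = w ∧ e.snd = v) ∨ (e.fst = v ∧ e.snd = u) ∨ (e.fst = u ∧ e.snd = w)

/-- A fixed point of face tracing would be a loop, and an orbit closing after two steps would have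
fewer than three darts. So an orbit of size three is `d, s d, s (s d)` and returns to `d`. -/
lemma exists_isTriangleOn (d : G.Dart) (h : R.IsTriangle (R.faceOf d)) :
    ∃ u, R.IsTriangleOn (R.faceOf d) d.fst d.snd u := by
  set s := R.faceStep with hs
  have hne : ∀ e, s e ≠ e := fun e he => e.fst_ne_snd (by rw [← R.faceStep_fst e, ← hs, he])
  have hfin : (R.faceDarts (R.faceOf d)).Finite := by
    refine Set.finite_of_ncard_ne_zero ?_
    rw [h]; decide
  -- A finite set stable under the injection `s` is also stable under `s⁻¹`, hence contains the
  -- whole orbit of each of its elements.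
  have hsub : ∀ T : Set G.Dart, d ∈ T → (∀ e ∈ T, s e ∈ T) → T.Finite →
      R.faceDarts (R.faceOf d) ⊆ T := by
    intro T hd hT hTf e he
    have hse : R.faceStep.SameCycle d e := (R.faceOf_eq_iff.1 he).symm
    obtain ⟨i, hi⟩ := hse
    have hinv : ∀ e ∈ T, s⁻¹ e ∈ T := by
      have himg : s '' T = T := by
        refine Set.eq_of_subset_of_ncard_le (Set.image_subset_iff.2 hT) ?_ hTf
        rw [Set.ncard_image_of_injective _ s.injective]
      intro e he
      obtain ⟨e', he', rfl⟩ := himg.ge he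
      simpa using he'
    have hz : ∀ i : ℤ, (s ^ i) d ∈ T := by
      intro i
      induction i with
      | zero => simpa using hd
      | succ i ih =>
        rw [add_comm, zpow_add, zpow_one, Equiv.Perm.mul_apply]
        exact hT _ ih
      | pred i ih =>
        rw [sub_eq_add_neg, add_comm, zpow_add, zpow_neg_one, Equiv.Perm.mul_apply]
        exact hinv _ ih
    rw [← hi]
    exact hz i
  have h02 : s (s d) ≠ d := by
    intro h2
    have := Set.ncard_le_ncard (hsub {d, s d} (by simp) (by simp [h2]) (by simp))
    have h3 : (R.faceDarts (R.faceOf d)).ncard = 3 := h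
    rw [Set.ncard_pair (hne d).symm] at this
    omega
  have hset : R.faceDarts (R.faceOf d) = {d, s d, s (s d)} := by
    symm
    refine Set.eq_of_subset_of_ncard_le ?_ ?_ hfin
    · rintro e (rfl | rfl | rfl)
      · rfl
      · exact R.faceOf_faceStep d
      · exact (R.faceOf_faceStep _).trans (R.faceOf_faceStep d)
    · have h3 : (R.faceDarts (R.faceOf d)).ncard = 3 := h
      rw [h3, Set.ncard_eq_three.2 ⟨d, s d, s (s d), (hne d).symm, h02.symm, (hne _).symm, rfl⟩]
  have h3 : s (s (s d)) = d := by
    have : s (s (s d)) ∈ R.faceDarts (R.faceOf d) := by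
      change R.faceOf _ = _
      rw [hs]; simp
    rw [hset] at this
    rcases this with h | h | h
    · exact h
    · exact (h02 (s.injective h)).elim
    · exact (hne _ h).elim
  have f1 : (s d).fst = d.snd := R.faceStep_fst d
  have f2 : (s (s d)).fst = (s d).snd := R.faceStep_fst _
  have f3 : (s (s d)).snd = d.fst := by rw [← R.faceStep_fst, ← hs, h3]
  refine ⟨(s d).snd, d.adj, f1 ▸ (s d).adj, f3 ▸ f2 ▸ (s (s d)).adj, fun e => ?_⟩
  have : R.faceOf e = R.faceOf d ↔ e ∈ R.faceDarts (R.faceOf d) := Iff.rfl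
  rw [this, hset, Set.mem_insert_iff, Set.mem_insert_iff, Set.mem_singleton_iff]
  simp only [SimpleGraph.Dart.ext_iff, Prod.ext_iff, f1, f2, f3]

variable {R}

lemma IsTriangleOn.boundary_eq {f : R.Face} {w v u : V} (h : R.IsTriangleOn f w v u)
    (d : G.Dart) :
    R.boundary {f} d = unitFlow w v d + unitFlow v u d + unitFlow u w d := by
  obtain ⟨h1, h2, h3, h4⟩ := h
  have key : ∀ e : G.Dart, (if R.faceOf e ∈ ({f} : Finset R.Face) then (1 : ℤ) else 0)
      = (if e.fst = w ∧ e.snd = v then 1 else 0) + (if e.fst = v ∧ e.snd = u then 1 else 0)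
        + (if e.fst = u ∧ e.snd = w then 1 else 0) := by
    intro e
    simp only [Finset.mem_singleton, h4 e]
    have := h1.ne
    have := h2.ne
    have := h3.ne
    split_ifs <;> simp_all
  have k1 := key d
  have k2 := key d.symm
  have e1 : d.symm.fst = d.snd := rfl
  have e2 : d.symm.snd = d.fst := rfl
  simp only [boundary, jump, unitFlow]
  rw [k1, k2, e1, e2]
  simp only [and_comm (a := d.snd = _)]
  ring

variable (R)

/-- A set `S` of triangular faces whose boundary is the simple cycle through the list `l`.
A list of length two stands for a single edge; then `S` is empty. -/
structure IsDisc (outer : R.Face) (l : List V) (S : Finset R.Face) : Prop where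
  nodup : l.Nodup
  two_le : 2 ≤ l.length
  chain : List.IsChain G.Adj (l ++ l.take 1)
  triangle : ∀ f ∈ S, R.IsTriangle f
  outer_notMem : outer ∉ S
  boundary_eq : ∀ d, R.boundary S d = pathFlow (l ++ l.take 1) d

variable {R} {outer : R.Face} {l : List V} {S : Finset R.Face}

/-- A closed flow does not depend on its starting point, so any boundary vertex can be put first. -/
lemma IsDisc.rotate {p q : List V} (h : R.IsDisc outer (p ++ q) S) : R.IsDisc outer (q ++ p) S := by
  cases p with
  | nil => simpa using h
  | cons a p =>
    cases q with
    | nil => simpa using h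
    | cons b q =>
      obtain ⟨h1, h2, h3, h4, h5, h6⟩ := h
      have e1 : (a :: p ++ b :: q) ++ (a :: p ++ b :: q).take 1
        = (a :: p) ++ b :: (q ++ [a]) := by simp
      have e2 : (b :: q ++ a :: p) ++ (b :: q ++ a :: p).take 1
        = (b :: q) ++ a :: (p ++ [b]) := by simp
      rw [e1] at h3 h6
      refine ⟨?_, ?_, ?_, h4, h5, ?_⟩
      · exact List.nodup_append_comm.1 h1
      · rw [List.length_append, add_comm, ← List.length_append]; exact h2
      · rw [e2]
        rw [List.isChain_split] at h3 ⊢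
        exact h3.symm
      · intro d
        rw [e2, h6, pathFlow_append, pathFlow_append (b :: q), add_comm]
        rfl

/-- A set of faces with zero boundary that avoids some face is empty. -/
lemma eq_empty_of_boundary_eq_zero [Finite V] (hG : G.Connected) (ho : outer ∉ S)
    (h : ∀ d, R.boundary S d = 0) : S = ∅ := by
  refine Finset.eq_empty_of_forall_notMem fun f hf => ho ?_
  have := R.eq_of_forall_jump hG (fun g => g ∈ S)
    (fun d => propext (R.boundary_eq_zero_iff.1 (h d))) f outer
  exact this.mp hf

lemma IsDisc.eq_empty_of_pair [Finite V] (hG : G.Connected) {a b : V}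
    (h : R.IsDisc outer [a, b] S) : S = ∅ := by
  refine eq_empty_of_boundary_eq_zero hG h.outer_notMem fun d => ?_
  rw [h.boundary_eq]
  simp [unitFlow_swap b a]

/-- The cyclic order of `l` is an orientation: the disc lies on the side of the darts that follow
it. A two-vertex list must be excluded, since its disc has no faces. -/
lemma IsDisc.boundary_first {a b : V} {t : List V} (h : R.IsDisc outer (a :: b :: t) S)
    (ht : t ≠ []) {d : G.Dart} (ha : d.fst = a) (hb : d.snd = b) :
    R.faceOf d ∈ S ∧ R.faceOf d.symm ∉ S := by
  rw [← R.boundary_eq_one_iff, h.boundary_eq]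
  exact pathFlow_closed_eq_one h.nodup ht ha hb

lemma IsDisc.adj_first {a b : V} {t : List V} (h : R.IsDisc outer (a :: b :: t) S) :
    G.Adj a b := by
  have := h.chain
  simp only [List.cons_append, List.isChain_cons_cons] at this
  exact this.1

/-- All faces at an inner vertex of a disc belong to the disc. -/
lemma IsDisc.faceOf_mem [Finite V] (h : R.IsDisc outer l S) {d e : G.Dart} (hd : d.fst ∉ l)
    (hS : R.faceOf d ∈ S) (he : e.fst = d.fst) : R.faceOf e ∈ S := by
  refine (R.eq_of_forall_fst_eq (fun g => g ∈ S) (v := d.fst) (fun d' hd' => ?_) rfl he).mp hS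
  refine propext (R.boundary_eq_zero_iff.1 ?_)
  rw [h.boundary_eq]
  refine pathFlow_eq_zero_of_fst_notMem ?_
  rw [hd', List.mem_append, not_or]
  exact ⟨hd, fun hm => hd (List.mem_of_mem_take hm)⟩

/-- Some face at a boundary vertex of a disc does not belong to the disc. -/
lemma IsDisc.exists_faceOf_notMem [Finite V] (hG : G.Connected) (h : R.IsDisc outer l S) {x : V}
    (hx : x ∈ l) : ∃ e : G.Dart, e.fst = x ∧ R.faceOf e ∉ S := by
  obtain ⟨p, q, rfl⟩ := List.append_of_mem hx
  have h' := h.rotate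
  have hlen := h'.two_le
  rw [List.cons_append] at h' hlen
  generalize q ++ p = t at h' hlen
  match t with
  | [] => simp at hlen
  | [y] =>
    refine ⟨⟨(x, y), h'.adj_first⟩, rfl, fun hm => ?_⟩
    have := h'.eq_empty_of_pair hG
    simp [this] at hm
  | y :: b :: t =>
    have hb := h'.boundary_first (by simp) (d := ⟨(x, y), h'.adj_first⟩) rfl rfl
    refine ⟨R.faceStep (Dart.symm ⟨(x, y), h'.adj_first⟩), R.faceStep_fst _, ?_⟩
    rw [faceOf_faceStep]
    exact hb.2

/-- Subtracting the flow around the triangle cancels `wv` and puts the detour `w, u, v` in its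
place. -/
lemma IsDisc.erase_insert {f : R.Face} {w v u : V} {t : List V}
    (h : R.IsDisc outer (w :: v :: t) S) (hf : f ∈ S) (hT : R.IsTriangleOn f w v u)
    (hu : u ∉ w :: v :: t) : R.IsDisc outer (w :: u :: v :: t) (S.erase f) := by
  obtain ⟨h1, h2, h3, h4, h5, h6⟩ := h
  refine ⟨?_, by simp, ?_, fun g hg => h4 g (Finset.mem_of_mem_erase hg),
    fun ho => h5 (Finset.mem_of_mem_erase ho), fun d => ?_⟩
  · simp only [List.nodup_cons, List.mem_cons, not_or] at h1 hu ⊢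
    tauto
  · simp only [List.take_succ_cons, List.take_zero, List.cons_append,
      List.isChain_cons_cons] at h3 ⊢
    exact ⟨hT.2.2.1.symm, hT.2.1.symm, h3.2⟩
  · rw [R.boundary_erase hf, h6, hT.boundary_eq]
    simp only [List.take_succ_cons, List.take_zero, List.cons_append, pathFlow_cons_cons]
    rw [unitFlow_swap w u, unitFlow_swap u v]
    ring

/-- A triangle on a boundary edge `wv` whose third vertex `u` is on the boundary splits the rest
of the disc into two discs. -/
lemma IsDisc.split [Fintype V] (hR : R.IsPlane) {f : R.Face} {w v u : V} {A B : List V}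
    (hD : R.IsDisc outer (w :: v :: (A ++ u :: B)) S) (hf : f ∈ S)
    (hT : R.IsTriangleOn f w v u) :
    ∃ S₁ S₂ : Finset R.Face, Disjoint S₁ S₂ ∧ S₁ ∪ S₂ = S.erase f ∧
      R.IsDisc outer (v :: (A ++ [u])) S₁ ∧ R.IsDisc outer (w :: u :: B) S₂ := by
  obtain ⟨h1, h2, h3, h4, h5, h6⟩ := hD
  simp only [List.take_succ_cons, List.take_zero, List.cons_append, List.append_assoc] at h3 h6
  have h3' := h3
  rw [List.isChain_cons_cons, ← List.cons_append, List.isChain_split] at h3'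
  obtain ⟨-, hc1, hc2⟩ := h3'
  have hch1 : List.IsChain G.Adj (v :: (A ++ [u]) ++ [v]) := by
    have : v :: (A ++ [u]) ++ [v] = (v :: A) ++ u :: [v] := by simp
    rw [this, List.isChain_split]
    exact ⟨hc1, by simpa using hT.2.1.symm⟩
  have hch2 : List.IsChain G.Adj (w :: u :: B ++ [w]) := by
    simp only [List.cons_append, List.isChain_cons_cons]
    exact ⟨hT.2.2.1.symm, hc2⟩
  set z₁ : G.Dart → ℤ := pathFlow (v :: (A ++ [u]) ++ [v]) with hz₁
  set z₂ : G.Dart → ℤ := pathFlow (w :: u :: B ++ [w]) with hz₂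
  have hz₁s : ∀ d, z₁ d = pathFlow (v :: (A ++ [u])) d + unitFlow u v d := by
    intro d
    have : v :: (A ++ [u]) ++ [v] = (v :: A) ++ u :: [v] := by simp
    rw [hz₁, this, pathFlow_append]
    simp
  have htot : ∀ d, R.boundary (S.erase f) d = z₁ d + z₂ d := by
    intro d
    rw [R.boundary_erase hf, h6, hT.boundary_eq, hz₁s, hz₂, pathFlow_cons_cons,
      ← List.cons_append (a := v), pathFlow_append]
    simp only [List.cons_append, pathFlow_cons_cons]
    rw [unitFlow_swap w u, unitFlow_swap u v]
    ring
  have hb₁ : IsBalanced z₁ := isBalanced_pathFlow_closed v (A ++ [u]) hch1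
  obtain ⟨h, hh⟩ := R.exists_jump_eq hR (fun d => (z₁ d : ℚ))
    (fun d => by rw [hz₁, pathFlow_symm]; push_cast; rfl)
    (fun x => by have := hb₁ x; beta_reduce; exact_mod_cast this)
  simp only [jump] at hh
  -- The potential `h` of the cycle `v, A, u` is normalized by its value at `f`, which lies outside
  -- that cycle; the faces with a different value are those enclosed.
  set S₁ := (S.erase f).filter fun g => h g ≠ h f with hS₁
  set S₂ := (S.erase f).filter fun g => h g = h f with hS₂
  have hfS₁ : f ∉ S₁ := by simp [hS₁]
  have hnd := h1
  simp only [List.nodup_cons, List.mem_cons, List.mem_append, not_or] at hnd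
  obtain ⟨⟨hwv, hwA, hwu, hwB⟩, ⟨hvA, hvu, hvB⟩, hAB⟩ := hnd
  have hy : ∀ d, R.boundary S₁ d - z₁ d = 0 := by
    have hysymm : ∀ d, R.boundary S₁ d.symm - z₁ d.symm = - (R.boundary S₁ d - z₁ d) := by
      intro d
      rw [boundary_symm, hz₁, pathFlow_symm]
      ring
    have hsymm0 : ∀ d, R.boundary S₁ d.symm - z₁ d.symm = 0 → R.boundary S₁ d - z₁ d = 0 := by
      intro d hd
      rw [hysymm] at hd
      omega
    -- The old boundary without `wv` is a simple path. Off this path the two chains are compared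
    -- edge by edge: on `wu` and `uv` by means of the adjacent face `f`, and elsewhere because
    -- neither `h` nor membership in `S.erase f` changes across the edge.
    have hpath : ((v :: A) ++ u :: (B ++ [w])).Nodup := by
      have : w :: v :: (A ++ u :: B) = [w] ++ (v :: (A ++ u :: B)) := rfl
      rw [this, List.nodup_append_comm] at h1
      simpa using h1
    refine eq_zero_of_support_onPath hysymm ?_ hpath fun d hd => ?_
    · intro x
      have e1 := R.isBalanced_jump (fun g => if g ∈ S₁ then (1 : ℤ) else 0) x
      have e2 := hb₁ x
      refine Eq.trans ?_ (sub_eq_zero.2 (e1.trans e2.symm))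
      rw [← Finset.sum_sub_distrib]
      refine Finset.sum_congr rfl fun d _ => ?_
      split_ifs
      · rfl
      · rfl
    · rw [onPath_append, not_or] at hd
      by_cases hwu' : d.edge = s(w, u)
      · have key : ∀ e : G.Dart, e.fst = w → e.snd = u → R.boundary S₁ e - z₁ e = 0 := by
          intro e hew heu
          have hz : z₁ e = 0 := by
            refine pathFlow_eq_zero_of_fst_notMem ?_
            rw [hew]
            simp [hwv, hwA, hwu]
          have hfe : R.faceOf e.symm = f := (hT.2.2.2 _).2 (Or.inr (Or.inr ⟨heu, hew⟩))
          have hj := hh e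
          rw [hz, hfe, Int.cast_zero, sub_eq_zero] at hj
          rw [hz, sub_zero, R.boundary_eq_zero_iff, hfe]
          simp [hS₁, hj]
        rw [dart_edge_eq_mk'_iff'] at hwu'
        rcases hwu' with ⟨e1, e2⟩ | ⟨e1, e2⟩
        · exact key d e1 e2
        · exact hsymm0 d (key d.symm e2 e1)
      by_cases huv' : d.edge = s(u, v)
      · have hA : A ≠ [] := by
          rintro rfl
          refine hd.1 ?_
          rw [huv', Sym2.eq_swap]
          simp
        have key : ∀ e : G.Dart, e.fst = u → e.snd = v → R.boundary S₁ e - z₁ e = 0 := by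
          intro e heu hev
          have hz : z₁ e = 1 := by
            have hn : (u :: v :: A).Nodup := by
              have hA' := (List.nodup_append.1 hAB)
              simp only [List.nodup_cons, List.mem_cons, not_or]
              refine ⟨⟨Ne.symm hvu, fun hu => ?_⟩, hvA, hA'.1⟩
              exact hA'.2.2 u hu u (by simp) rfl
            have := pathFlow_closed_eq_one hn hA heu hev
            rw [hz₁s]
            simp only [List.cons_append, pathFlow_cons_cons] at this ⊢
            omega
          have hz2 : z₂ e = 0 := by
            refine pathFlow_eq_zero_of_snd_notMem ?_
            rw [hev]
            simp [Ne.symm hwv, hvu, hvB]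
          have ht := htot e
          rw [hz, hz2, add_zero, R.boundary_eq_one_iff] at ht
          have hfe : R.faceOf e.symm = f := (hT.2.2.2 _).2 (Or.inr (Or.inl ⟨hev, heu⟩))
          have hj := hh e
          rw [hz, hfe] at hj
          rw [hz, sub_eq_zero, R.boundary_eq_one_iff, hfe]
          refine ⟨Finset.mem_filter.2 ⟨ht.1, fun he => ?_⟩, hfS₁⟩
          rw [he, sub_self] at hj
          norm_num at hj
        rw [dart_edge_eq_mk'_iff'] at huv'
        rcases huv' with ⟨e1, e2⟩ | ⟨e1, e2⟩
        · exact key d e1 e2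
        · exact hsymm0 d (key d.symm e2 e1)
      have hz : z₁ d = 0 := by
        rw [hz₁s]
        have p1 : pathFlow (v :: (A ++ [u])) d = 0 := by
          by_contra hne
          exact hd.1 (onPath_of_pathFlow_ne_zero hne)
        have p2 : unitFlow u v d = 0 := by
          by_contra hne
          exact huv' (edge_eq_of_unitFlow_ne_zero hne)
        rw [p1, p2, add_zero]
      have hz2 : z₂ d = 0 := by
        by_contra hne
        rcases onPath_of_pathFlow_ne_zero hne with h | h
        · exact hwu' h
        · exact hd.2 h
      have ht := htot d
      rw [hz, hz2, add_zero, R.boundary_eq_zero_iff] at ht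
      have hj := hh d
      rw [hz, Int.cast_zero, sub_eq_zero] at hj
      rw [hz, sub_zero, R.boundary_eq_zero_iff, hS₁, Finset.mem_filter, Finset.mem_filter, ht, hj]
  have hdisj : Disjoint S₁ S₂ := by
    rw [Finset.disjoint_left]
    intro g hg1 hg2
    exact (Finset.mem_filter.1 hg1).2 (Finset.mem_filter.1 hg2).2
  have hunion : S₁ ∪ S₂ = S.erase f := by
    rw [Finset.union_comm]
    exact Finset.filter_union_filter_not_eq _ _
  have hsum : ∀ d, R.boundary S₁ d + R.boundary S₂ d = R.boundary (S.erase f) d := by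
    intro d
    have : ∀ g : R.Face, (if g ∈ S.erase f then (1 : ℤ) else 0)
        = (if g ∈ S₁ then 1 else 0) + (if g ∈ S₂ then 1 else 0) := by
      intro g
      by_cases hg : h g = h f
      · simp [hS₁, hS₂, hg]
      · simp [hS₁, hS₂, hg]
    simp only [boundary, jump, this]
    ring
  have hm₁ : ∀ g ∈ S₁, g ∈ S := fun g hg => Finset.mem_of_mem_erase (Finset.mem_filter.1 hg).1
  have hm₂ : ∀ g ∈ S₂, g ∈ S := fun g hg => Finset.mem_of_mem_erase (Finset.mem_filter.1 hg).1
  have hnA : (A ++ [u]).Nodup := by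
    have : A ++ u :: B = (A ++ [u]) ++ B := by simp
    rw [this] at hAB
    exact (List.nodup_append.1 hAB).1
  refine ⟨S₁, S₂, hdisj, hunion, ⟨?_, by simp, hch1, fun g hg => h4 g (hm₁ g hg),
    fun ho => h5 (hm₁ _ ho), fun d => sub_eq_zero.1 (hy d)⟩, ⟨?_, by simp, hch2,
    fun g hg => h4 g (hm₂ g hg), fun ho => h5 (hm₂ _ ho), fun d => ?_⟩⟩
  · rw [List.nodup_cons]
    refine ⟨?_, hnA⟩
    simp [hvA, hvu]
  · rw [List.nodup_cons, List.mem_cons, not_or]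
    exact ⟨⟨hwu, hwB⟩, (List.nodup_append.1 hAB).2.1⟩
  · have e1 := hsum d
    have e2 := htot d
    have e3 := hy d
    change _ = z₂ d
    omega

end RotationSystem

/-! ### The coloring condition on darts. -/

namespace SimpleGraph.Signature

variable {V : Type*} {G : SimpleGraph V} (σ : G.Signature)

lemma sign_symm {u v : V} (h : G.Adj u v) : σ.sign h.symm = σ.sign h := by
  simp only [sign, Sym2.eq_swap]

lemma sign_mul_self {u v : V} (h : G.Adj u v) : σ.sign h * σ.sign h = 1 := by
  rw [sign, ← Units.val_mul, Int.units_mul_self, Units.val_one]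

/-- Signs square to one. Hence an edge may be checked at whichever of its two darts lies in the
disc. -/
lemma ne_sign_mul_comm {u v : V} (h : G.Adj u v) {a b : ℤ} (hab : a ≠ σ.sign h * b) :
    b ≠ σ.sign h.symm * a := by
  rintro rfl
  rw [sign_symm σ h, ← mul_assoc, sign_mul_self, one_mul] at hab
  exact hab rfl

/-- The coloring condition on the edge of a dart. -/
def Good (c : V → ℤ) (d : G.Dart) : Prop := c d.fst ≠ σ.sign d.adj * c d.snd

variable {σ}

lemma Good.symm {c : V → ℤ} {d : G.Dart} (h : σ.Good c d) : σ.Good c d.symm :=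
  σ.ne_sign_mul_comm d.adj h

lemma Good.congr {c c' : V → ℤ} {d : G.Dart} (h : σ.Good c d) (h1 : c' d.fst = c d.fst)
    (h2 : c' d.snd = c d.snd) : σ.Good c' d := by
  rw [Good, h1, h2]; exact h

lemma good_of_eq {c : V → ℤ} {a b : V} {x y : ℤ} {d : G.Dart} (h1 : d.fst = a) (h2 : d.snd = b)
    (hx : c a = x) (hy : c b = y) (h : ∀ h : G.Adj a b, x ≠ σ.sign h * y) : σ.Good c d := by
  subst h1 h2 hx hy
  exact h d.adj

end SimpleGraph.Signature

/-! ### Thomassen's induction on discs. -/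

namespace RotationSystem

open SimpleGraph

variable {V : Type*} {G : SimpleGraph V} (R : RotationSystem G)

/-- The vertices of the disc with boundary cycle `l` and set of faces `S`. -/
def InDisc (l : List V) (S : Finset R.Face) (x : V) : Prop :=
  x ∈ l ∨ ∃ d : G.Dart, d.fst = x ∧ R.faceOf d ∈ S

/-- `c` is an `L`-coloring of the disc with boundary cycle `l` and set of faces `S`, apart from
the edges of the darts in `X`. -/
def ColorsDisc (σ : G.Signature) (L : V → Finset ℤ) (l : List V) (S : Finset R.Face)
    (X : Set G.Dart) (c : V → ℤ) : Prop :=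
  (∀ x, R.InDisc l S x → c x ∈ L x) ∧ ∀ d, R.faceOf d ∈ S → d ∉ X → σ.Good c d

/-- Every precoloring of an edge of the boundary of a disc on the faces `S` extends to the disc,
for lists of size three on the boundary and five inside. -/
def EdgeExtendable (outer : R.Face) (σ : G.Signature) (S : Finset R.Face) : Prop :=
  ∀ (v₁ v₂ : V) (t : List V) (L : V → Finset ℤ) (c₁ c₂ : ℤ),
    R.IsDisc outer (v₁ :: v₂ :: t) S → L v₁ = {c₁} → L v₂ = {c₂} →
    (∀ h : G.Adj v₁ v₂, c₁ ≠ σ.sign h * c₂) → (∀ x ∈ t, 3 ≤ (L x).card) →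
    (∀ d : G.Dart, R.faceOf d ∈ S → d.fst ∉ v₁ :: v₂ :: t → 5 ≤ (L d.fst).card) →
    ∃ c, R.ColorsDisc σ L (v₁ :: v₂ :: t) S ∅ c

/-- The same with, in addition, a boundary vertex `w` with a list of size two, which is followed on
the boundary by vertices `U` and the precolored edge `v₁v₂`; the vertices in `U` and `v₁` are
not adjacent to `w` within the disc, except that the first one, `v`, is its successor on the
boundary, and the edge `wv` may be disregarded. -/
def FanExtendable (outer : R.Face) (σ : G.Signature) (S : Finset R.Face) : Prop :=
  ∀ (w v : V) (T U : List V) (v₁ v₂ : V) (t : List V) (L : V → Finset ℤ) (c₁ c₂ : ℤ),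
    R.IsDisc outer (w :: v :: T) S → v :: T = U ++ v₁ :: v₂ :: t → L v₁ = {c₁} → L v₂ = {c₂} →
    (∀ h : G.Adj v₁ v₂, c₁ ≠ σ.sign h * c₂) → (L w).card = 2 →
    (∀ x ∈ U, 3 ≤ (L x).card) → (∀ x ∈ t, 3 ≤ (L x).card) →
    (∀ d : G.Dart, R.faceOf d ∈ S → d.fst ∉ w :: v :: T → 5 ≤ (L d.fst).card) →
    (∀ x, x ∈ U ∨ x = v₁ → ∀ d : G.Dart, d.fst = x → d.snd = w → R.faceOf d ∉ S) →
    ∃ c, R.ColorsDisc σ L (w :: v :: T) S {d | d.fst = w ∧ d.snd = v} c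

variable {R} {outer : R.Face} {σ : G.Signature} {S : Finset R.Face}

/-- The fan starts at the predecessor `w` of `v₁`, with `U` empty and `v = v₁`. Its two reserved
colors avoid the one excluded by `c₁`, which settles the edge `wv₁` that the fan statement
disregards. -/
lemma edgeExtendable_of_fanExtendable [Finite V] (hG : G.Connected)
    (h : R.FanExtendable outer σ S) : R.EdgeExtendable outer σ S := by
  intro v₁ v₂ t L c₁ c₂ hD hL₁ hL₂ hc h3 h5
  rcases List.eq_nil_or_concat t with rfl | ⟨t, w, rfl⟩
  · have hS := hD.eq_empty_of_pair hG
    subst hS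
    have hne := hD.adj_first.ne
    refine ⟨fun x => if x = v₁ then c₁ else c₂, ?_, by simp⟩
    rintro x (hx | ⟨d, -, hd⟩)
    · simp only [List.mem_cons, List.not_mem_nil, or_false] at hx
      rcases hx with rfl | rfl
      · simp [hL₁]
      · simp [hL₂, hne.symm]
    · simp at hd
  · rw [List.concat_eq_append] at *
    have hD' : R.IsDisc outer (w :: v₁ :: v₂ :: t) S := by
      have : v₁ :: v₂ :: (t ++ [w]) = (v₁ :: v₂ :: t) ++ [w] := by simp
      rw [this] at hD
      exact hD.rotate
    have hadj := hD'.adj_first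
    have hnd := hD'.nodup
    simp only [List.nodup_cons, List.mem_cons, not_or] at hnd
    obtain ⟨⟨hw1, hw2, hwt⟩, -⟩ := hnd
    have hcard : 2 ≤ ((L w).erase (σ.sign hadj * c₁)).card := by
      have h1 := h3 w (by simp)
      have h2 := Finset.pred_card_le_card_erase (s := L w) (a := σ.sign hadj * c₁)
      omega
    obtain ⟨M, hM, hM2⟩ := Finset.exists_subset_card_eq hcard
    obtain ⟨c, hcL, hcg⟩ := h w v₁ (v₂ :: t) [] v₁ v₂ t (Function.update L w M) c₁ c₂ hD' rfl
      (by rw [Function.update_of_ne (Ne.symm hw1), hL₁])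
      (by rw [Function.update_of_ne (Ne.symm hw2), hL₂]) hc (by simpa using hM2) (by simp)
      (fun x hx => by
        rw [Function.update_of_ne (ne_of_mem_of_not_mem hx hwt)]
        exact h3 x (by simp [hx]))
      (fun d hd hdn => by
        rw [Function.update_of_ne (fun h => hdn (by simp [h]))]
        refine h5 d hd ?_
        simp only [List.mem_cons, List.mem_append, not_or] at hdn ⊢
        simp
        tauto)
      (by
        rintro x (hx | rfl) d h1 h2
        · simp at hx
        · have := (hD'.boundary_first (by simp) (d := d.symm) h2 h1).2
          rwa [Dart.symm_symm] at this)
    have hcw := hcL w (Or.inl (by simp))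
    rw [Function.update_self] at hcw
    refine ⟨c, fun x hx => ?_, fun d hd _ => ?_⟩
    · have hx' : R.InDisc (w :: v₁ :: v₂ :: t) S x := by
        refine hx.imp_left fun hx => ?_
        simp only [List.mem_cons, List.mem_append, List.not_mem_nil, or_false] at hx ⊢
        tauto
      have := hcL x hx'
      by_cases hxw : x = w
      · subst hxw
        exact Finset.mem_of_mem_erase (hM hcw)
      · rwa [Function.update_of_ne hxw] at this
    · by_cases hdw : d.fst = w ∧ d.snd = v₁
      · have hc1 := hcL v₁ (Or.inl (by simp))
        rw [Function.update_of_ne (Ne.symm hw1), hL₁, Finset.mem_singleton] at hc1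
        exact Signature.good_of_eq hdw.1 hdw.2 rfl hc1
          fun _ => (Finset.mem_erase.1 (hM hcw)).1
      · exact hcg d hd hdw

lemma inDisc_snd {l : List V} {d : G.Dart} (hd : R.faceOf d ∈ S) : R.InDisc l S d.snd :=
  Or.inr ⟨R.faceStep d, R.faceStep_fst d, by rwa [faceOf_faceStep]⟩

/-- One step of the fan: the triangle on `wv` is removed, and its third vertex `u` decides between
continuing the fan on one smaller disc and splitting into two. -/
lemma fanExtendable_of_ssubset [Fintype V] (hR : R.IsPlane)
    (hA : ∀ S' ⊂ S, R.EdgeExtendable outer σ S') (hB : ∀ S' ⊂ S, R.FanExtendable outer σ S') :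
    R.FanExtendable outer σ S := by
  intro w v T U v₁ v₂ t L c₁ c₂ hD hT hL₁ hL₂ hc hw hU ht h5 hfan
  have hG := hR.1
  have hadj := hD.adj_first
  have hTne : T ≠ [] := by
    rintro rfl
    have := congrArg List.length hT
    simp at this
    omega
  set d₀ : G.Dart := ⟨(w, v), hadj⟩ with hd₀
  have hf : R.faceOf d₀ ∈ S := (hD.boundary_first hTne rfl rfl).1
  obtain ⟨u, htri⟩ := R.exists_isTriangleOn d₀ (hD.triangle _ hf)
  set f := R.faceOf d₀ with hfdef
  change R.IsTriangleOn f w v u at htri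
  obtain ⟨-, hvu, huw, hdarts⟩ := htri
  have hmemT : ∀ x, x ∈ v :: T ↔ x ∈ U ∨ x = v₁ ∨ x = v₂ ∨ x ∈ t := by
    intro x
    rw [hT]
    simp
  have hnd := hD.nodup
  rw [hT] at hnd
  simp only [List.nodup_cons, List.nodup_append, List.mem_cons, List.mem_append, not_or,
    forall_eq_or_imp] at hnd
  obtain ⟨⟨hwU, hw1, hw2, hwt⟩, hUnd, ⟨⟨h12, h1t⟩, h2t, htnd⟩, hdis⟩ := hnd
  have huw_mem : ∀ d : G.Dart, d.fst = u → d.snd = w → R.faceOf d = f := fun d h1 h2 =>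
    (hdarts d).2 (Or.inr (Or.inr ⟨h1, h2⟩))
  -- The dart from `u` to `w` lies on `f`, which is in `S`; the fan hypothesis forbids this for `v₁`
  -- and the vertices of `U`. So a boundary vertex `u` comes after `v₁`, and the edge `v₁v₂` stays
  -- whole in the first piece.
  have hu' : u ∉ U ∧ u ≠ v₁ := by
    constructor
    · intro h
      exact hfan u (Or.inl h) ⟨(u, w), huw⟩ rfl rfl (by rwa [huw_mem ⟨(u, w), huw⟩ rfl rfl])
    · intro h
      exact hfan u (Or.inr h) ⟨(u, w), huw⟩ rfl rfl (by rwa [huw_mem ⟨(u, w), huw⟩ rfl rfl])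
  by_cases hul : u ∈ v :: T
  · -- the third vertex of the triangle is on the boundary
    have hu2 : u ∈ v₂ :: t := by
      have := (hmemT u).1 hul
      rw [List.mem_cons]
      tauto
    obtain ⟨A', B, hAB⟩ := List.append_of_mem hu2
    obtain ⟨A, hAeq⟩ : ∃ A, v :: A = U ++ v₁ :: A' := by
      cases U with
      | nil =>
        simp only [List.nil_append, List.cons.injEq] at hT
        exact ⟨A', by simp [hT.1]⟩
      | cons a U =>
        simp only [List.cons_append, List.cons.injEq] at hT
        exact ⟨U ++ v₁ :: A', by simp [hT.1]⟩
    have hTeq : T = A ++ u :: B := by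
      rw [hAB] at hT
      have : v :: T = v :: (A ++ u :: B) := by
        rw [← List.cons_append, hAeq, hT]; simp
      exact (List.cons.inj this).2
    obtain ⟨A'', hA''⟩ : ∃ A'', A' ++ [u] = v₂ :: A'' := by
      cases A' with
      | nil =>
        simp only [List.nil_append, List.cons.injEq] at hAB
        exact ⟨[], by simp [hAB.1]⟩
      | cons a A' =>
        simp only [List.cons_append, List.cons.injEq] at hAB
        exact ⟨A' ++ [u], by simp [hAB.1]⟩
    have ht_eq : t = A'' ++ B := by
      have : v₂ :: t = v₂ :: (A'' ++ B) := by
        rw [hAB, ← List.cons_append, ← hA'']; simp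
      exact (List.cons.inj this).2
    subst hTeq
    obtain ⟨S₁, S₂, hdisj, hunion, hD₁, hD₂⟩ := hD.split hR hf ⟨hadj, hvu, huw, hdarts⟩
    have hl₁ : v :: (A ++ [u]) = U ++ v₁ :: v₂ :: A'' := by
      rw [← List.cons_append, hAeq, ← hA'']; simp
    have hS₁ : ∀ g ∈ S₁, g ∈ S ∧ g ≠ f := fun g hg => by
      have := hunion.le (Finset.mem_union_left _ hg)
      exact ⟨Finset.mem_of_mem_erase this, Finset.ne_of_mem_erase this⟩
    have hS₂ : ∀ g ∈ S₂, g ∈ S ∧ g ≠ f := fun g hg => by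
      have := hunion.le (Finset.mem_union_right _ hg)
      exact ⟨Finset.mem_of_mem_erase this, Finset.ne_of_mem_erase this⟩
    have hss₁ : S₁ ⊂ S := Finset.ssubset_iff_of_subset (fun g hg => (hS₁ g hg).1) |>.2
      ⟨f, hf, fun h => (hS₁ f h).2 rfl⟩
    have hss₂ : S₂ ⊂ S := Finset.ssubset_iff_of_subset (fun g hg => (hS₂ g hg).1) |>.2
      ⟨f, hf, fun h => (hS₂ f h).2 rfl⟩
    have hint₁ : ∀ d : G.Dart, R.faceOf d ∈ S₁ → d.fst ∉ v :: (A ++ [u]) →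
        ∀ e : G.Dart, e.fst = d.fst → R.faceOf e ∈ S₁ :=
      fun d hd hdn e he => hD₁.faceOf_mem hdn hd he
    have hint₂ : ∀ d : G.Dart, R.faceOf d ∈ S₂ → d.fst ∉ w :: u :: B →
        ∀ e : G.Dart, e.fst = d.fst → R.faceOf e ∈ S₂ :=
      fun d hd hdn e he => hD₂.faceOf_mem hdn hd he
    -- A boundary vertex has some face outside `S`, while an inner vertex of a piece has all its
    -- faces in that piece. So inner vertices of the pieces are inner vertices of the disc and keep
    -- their five colors.
    have hbd : ∀ x ∈ w :: v :: (A ++ u :: B), ¬ ∀ e : G.Dart, e.fst = x → R.faceOf e ∈ S := by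
      intro x hx hall
      obtain ⟨e, he, hne⟩ := hD.exists_faceOf_notMem hG hx
      exact hne (hall e he)
    have hin₁ : ∀ d : G.Dart, R.faceOf d ∈ S₁ → d.fst ∉ v :: (A ++ [u]) →
        d.fst ∉ w :: v :: (A ++ u :: B) := fun d hd hdn hm =>
      hbd _ hm fun e he => (hS₁ _ (hint₁ d hd hdn e he)).1
    have hin₂ : ∀ d : G.Dart, R.faceOf d ∈ S₂ → d.fst ∉ w :: u :: B →
        d.fst ∉ w :: v :: (A ++ u :: B) := fun d hd hdn hm =>
      hbd _ hm fun e he => (hS₂ _ (hint₂ d hd hdn e he)).1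
    -- color the first disc
    have hD₁' : R.IsDisc outer (v₁ :: v₂ :: (A'' ++ U)) S₁ := by
      rw [hl₁] at hD₁
      exact hD₁.rotate
    have hmem₁ : ∀ x, x ∈ v :: (A ++ [u]) ↔ x ∈ v₁ :: v₂ :: (A'' ++ U) := by
      intro x
      rw [hl₁]
      simp only [List.mem_append, List.mem_cons]
      tauto
    obtain ⟨c', hc'L, hc'g⟩ := hA S₁ hss₁ v₁ v₂ (A'' ++ U) L c₁ c₂ hD₁' hL₁ hL₂ hc
      (fun x hx => by
        rcases List.mem_append.1 hx with hx | hx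
        · exact ht x (by simp [ht_eq, hx])
        · exact hU x hx)
      (fun d hd hdn => by
        rw [← hmem₁] at hdn
        exact h5 d (hS₁ _ hd).1 (hin₁ d hd hdn))
    have hc'L' : ∀ x, R.InDisc (v :: (A ++ [u])) S₁ x → c' x ∈ L x := fun x hx =>
      hc'L x (hx.imp_left (hmem₁ x).1)
    -- The edge `vu` borders the removed triangle; its other dart lies in the first piece, unless
    -- `A` is empty. In that case `vu` is the precolored edge `v₁v₂`.
    have hvu_good : ∀ e : G.Dart, e.fst = u → e.snd = v → σ.Good c' e := by
      intro e h1 h2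
      by_cases hAn : A = []
      · subst hAn
        have hlen := congrArg List.length hAeq
        simp only [List.length_cons, List.length_nil, List.length_append] at hlen
        have hU0 : U = [] := List.length_eq_zero_iff.1 (by omega)
        have hA0 : A' = [] := List.length_eq_zero_iff.1 (by omega)
        subst hU0 hA0
        simp only [List.nil_append, List.cons.injEq, and_true] at hAeq hA''
        have e1 := hc'L v₁ (Or.inl (by simp))
        have e2 := hc'L v₂ (Or.inl (by simp))
        rw [hL₁, Finset.mem_singleton] at e1
        rw [hL₂, Finset.mem_singleton] at e2
        have : σ.Good c' e.symm := Signature.good_of_eq (d := e.symm) (h2.trans hAeq)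
          (h1.trans hA''.1) e1 e2 hc
        simpa using this.symm
      · have hD₁r : R.IsDisc outer (u :: v :: A) S₁ := by
          rw [← List.cons_append] at hD₁
          exact hD₁.rotate
        exact hc'g e (hD₁r.boundary_first hAn h1 h2).1 (by simp)
    -- color the second disc
    obtain ⟨y, hyL, hy⟩ : ∃ y ∈ L w, y ≠ σ.sign huw.symm * c' u := by
      refine Finset.exists_mem_ne (by omega) _
    have hnd₂ := hD₂.nodup
    simp only [List.nodup_cons, List.mem_cons, not_or] at hnd₂
    obtain ⟨⟨hwu, hwB⟩, huB, hBnd⟩ := hnd₂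
    set L₂ := Function.update (Function.update L w {y}) u {c' u} with hL₂def
    have hL₂u : L₂ u = {c' u} := by simp [hL₂def]
    have hL₂w : L₂ w = {y} := by simp [hL₂def, hwu]
    have hL₂x : ∀ x, x ≠ w → x ≠ u → L₂ x = L x := fun x h1 h2 => by
      rw [hL₂def, Function.update_of_ne h2, Function.update_of_ne h1]
    obtain ⟨c'', hc''L, hc''g⟩ := hA S₂ hss₂ w u B L₂ y (c' u) hD₂ hL₂w hL₂u (fun _ => hy)
      (fun x hx => by
        rw [hL₂x x (fun h => hwB (h ▸ hx)) (fun h => huB (h ▸ hx))]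
        exact ht x (by simp [ht_eq, hx]))
      (fun d hd hdn => by
        have hdn' := hdn
        simp only [List.mem_cons, not_or] at hdn'
        rw [hL₂x _ hdn'.1 hdn'.2.1]
        exact h5 d (hS₂ _ hd).1 (hin₂ d hd hdn))
    have hc''u : c'' u = c' u := by
      have := hc''L u (Or.inl (by simp))
      rwa [hL₂u, Finset.mem_singleton] at this
    have hc''w : c'' w = y := by
      have := hc''L w (Or.inl (by simp))
      rwa [hL₂w, Finset.mem_singleton] at this
    have hmeet : ∀ x, R.InDisc (v :: (A ++ [u])) S₁ x → R.InDisc (w :: u :: B) S₂ x → x = u := by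
      intro x hx1 hx2
      by_cases hm1 : x ∈ v :: (A ++ [u])
      · by_cases hm2 : x ∈ w :: u :: B
        · have := hD.nodup
          simp only [List.nodup_cons, List.nodup_append, List.mem_cons, List.mem_append, not_or,
            forall_eq_or_imp, List.not_mem_nil, or_false] at this hm1 hm2
          grind
        · rcases hx2 with hx2 | ⟨d, rfl, hd⟩
          · exact (hm2 hx2).elim
          · refine (hin₂ d hd hm2 ?_).elim
            simp only [List.mem_cons, List.mem_append, List.not_mem_nil, or_false] at hm1 ⊢
            tauto
      · rcases hx1 with hx1 | ⟨d, rfl, hd⟩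
        · exact (hm1 hx1).elim
        · by_cases hm2 : d.fst ∈ w :: u :: B
          · refine (hin₁ d hd hm1 ?_).elim
            simp only [List.mem_cons, List.mem_append] at hm2 ⊢
            tauto
          · rcases hx2 with hx2 | ⟨e, hed, he⟩
            · exact (hm2 hx2).elim
            · exact (Finset.disjoint_left.1 hdisj (hint₁ d hd hm1 e hed) he).elim
    set c : V → ℤ := fun x => if R.InDisc (w :: u :: B) S₂ x then c'' x else c' x with hcdef
    have hc2 : ∀ x, R.InDisc (w :: u :: B) S₂ x → c x = c'' x := fun x hx => if_pos hx
    have hc1 : ∀ x, R.InDisc (v :: (A ++ [u])) S₁ x → c x = c' x := fun x hx => by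
      by_cases hx2 : R.InDisc (w :: u :: B) S₂ x
      · rw [hc2 x hx2, hmeet x hx hx2, hc''u]
      · exact if_neg hx2
    have hcL1 : ∀ x, R.InDisc (v :: (A ++ [u])) S₁ x → c x ∈ L x := fun x hx => by
      rw [hc1 x hx]; exact hc'L' x hx
    have hcL2 : ∀ x, R.InDisc (w :: u :: B) S₂ x → c x ∈ L x := fun x hx => by
      rw [hc2 x hx]
      by_cases h1 : x = w
      · rw [h1, hc''w]; exact hyL
      by_cases h2 : x = u
      · rw [h2, hc''u]; exact hc'L' u (Or.inl (by simp))
      rw [← hL₂x x h1 h2]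
      exact hc''L x hx
    refine ⟨c, ?_, ?_⟩
    · have hl : ∀ x, x ∈ w :: v :: (A ++ u :: B) → c x ∈ L x := by
        intro x hx
        have : x ∈ v :: (A ++ [u]) ∨ x ∈ w :: u :: B := by
          simp only [List.mem_cons, List.mem_append, List.not_mem_nil, or_false] at hx ⊢
          tauto
        exact this.elim (fun h => hcL1 x (Or.inl h)) fun h => hcL2 x (Or.inl h)
      rintro x (hx | ⟨d, rfl, hd⟩)
      · exact hl x hx
      · by_cases hdf : R.faceOf d = f
        · refine hl _ ?_
          rcases (hdarts d).1 hdf with ⟨h, -⟩ | ⟨h, -⟩ | ⟨h, -⟩ <;> rw [h] <;> simp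
        · have := hunion.ge (Finset.mem_erase.2 ⟨hdf, hd⟩)
          rcases Finset.mem_union.1 this with h | h
          · exact hcL1 _ (Or.inr ⟨d, rfl, h⟩)
          · exact hcL2 _ (Or.inr ⟨d, rfl, h⟩)
    · intro d hd hdX
      by_cases hdf : R.faceOf d = f
      · rcases (hdarts d).1 hdf with h | ⟨h1, h2⟩ | ⟨h1, h2⟩
        · exact (hdX h).elim
        · have := (hvu_good d.symm h2 h1).symm
          rw [Dart.symm_symm] at this
          refine this.congr (hc1 _ (Or.inl ?_)) (hc1 _ (Or.inl ?_))
          · rw [h1]; simp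
          · rw [h2]; simp
        · have : σ.Good c d.symm := Signature.good_of_eq (d := d.symm) h2 h1
            ((hc2 w (Or.inl (by simp))).trans hc''w) (hc1 u (Or.inl (by simp))) fun _ => hy
          simpa using this.symm
      · have := hunion.ge (Finset.mem_erase.2 ⟨hdf, hd⟩)
        rcases Finset.mem_union.1 this with h | h
        · exact (hc'g d h (by simp)).congr (hc1 _ (Or.inr ⟨d, rfl, h⟩)) (hc1 _ (inDisc_snd h))
        · exact (hc''g d h (by simp)).congr (hc2 _ (Or.inr ⟨d, rfl, h⟩)) (hc2 _ (inDisc_snd h))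
  · -- the third vertex of the triangle is inside the disc
    have hul' : u ∉ w :: v :: T := by
      rw [List.mem_cons, not_or]
      exact ⟨huw.ne, hul⟩
    have hD' := hD.erase_insert hf ⟨hadj, hvu, huw, hdarts⟩ hul'
    have hu5 : 5 ≤ (L u).card := h5 ⟨(u, w), huw⟩
      (by rwa [huw_mem ⟨(u, w), huw⟩ rfl rfl]) hul'
    -- Whichever color `w` finally gets, no color in `N` conflicts with it along `uw`; at most two
    -- of the five colors are lost.
    set N := L u \ (L w).image fun x => σ.sign huw * x with hN
    have hN3 : 3 ≤ N.card := by
      have h1 := Finset.le_card_sdiff ((L w).image fun x => σ.sign huw * x) (L u)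
      have h2 := Finset.card_image_le (s := L w) (f := fun x => σ.sign huw * x)
      rw [← hN] at h1
      omega
    have huT := (hmemT u).not.1 hul
    simp only [not_or] at huT
    have hLx : ∀ x, x ≠ u → Function.update L u N x = L x := fun x hx =>
      Function.update_of_ne hx _ _
    obtain ⟨c, hcL, hcg⟩ := hB (S.erase f) (Finset.erase_ssubset hf) w u (v :: T) (u :: U) v₁ v₂ t
      (Function.update L u N) c₁ c₂ hD' (by rw [hT]; rfl)
      (by rw [hLx _ (Ne.symm huT.2.1), hL₁]) (by rw [hLx _ (Ne.symm huT.2.2.1), hL₂]) hc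
      (by rw [hLx _ huw.ne.symm, hw])
      (fun x hx => by
        rcases List.mem_cons.1 hx with rfl | hx
        · rwa [Function.update_self]
        · rw [hLx x (fun h => huT.1 (h ▸ hx))]
          exact hU x hx)
      (fun x hx => by
        rw [hLx x (fun h => huT.2.2.2 (h ▸ hx))]
        exact ht x hx)
      (fun d hd hdn => by
        simp only [List.mem_cons, not_or] at hdn
        rw [hLx _ hdn.2.1]
        refine h5 d (Finset.mem_of_mem_erase hd) ?_
        simp only [List.mem_cons, not_or]
        tauto)
      (fun x hx d h1 h2 hd => by
        rw [List.mem_cons, or_assoc] at hx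
        rcases hx with rfl | hx
        · exact Finset.ne_of_mem_erase hd (huw_mem d h1 h2)
        · exact hfan x hx d h1 h2 (Finset.mem_of_mem_erase hd))
    have hcw : c w ∈ L w := by
      have := hcL w (Or.inl (by simp))
      rwa [hLx _ huw.ne.symm] at this
    have hcu : c u ∈ N := by
      have := hcL u (Or.inl (by simp))
      rwa [Function.update_self] at this
    have hgood_uw : ∀ d : G.Dart, d.fst = u → d.snd = w → σ.Good c d := fun d h1 h2 =>
      Signature.good_of_eq h1 h2 rfl rfl fun _ h =>
        (Finset.mem_sdiff.1 hcu).2 (Finset.mem_image.2 ⟨c w, hcw, h.symm⟩)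
    have hgood : ∀ d : G.Dart, R.faceOf d ∈ S.erase f → σ.Good c d := fun d hd => by
      by_cases hdX : d.fst = w ∧ d.snd = u
      · have := (hgood_uw d.symm hdX.2 hdX.1).symm
        rwa [Dart.symm_symm] at this
      · exact hcg d hd hdX
    refine ⟨c, fun x hx => ?_, fun d hd hdX => ?_⟩
    · have hx' : R.InDisc (w :: u :: v :: T) (S.erase f) x := by
        rcases hx with hx | ⟨d, rfl, hd⟩
        · refine Or.inl ?_
          simp only [List.mem_cons] at hx ⊢
          tauto
        · by_cases hdf : R.faceOf d = f
          · refine Or.inl ?_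
            rcases (hdarts d).1 hdf with ⟨h, -⟩ | ⟨h, -⟩ | ⟨h, -⟩ <;> rw [h] <;> simp
          · exact Or.inr ⟨d, rfl, Finset.mem_erase.2 ⟨hdf, hd⟩⟩
      have := hcL x hx'
      by_cases hxu : x = u
      · subst hxu
        exact (Finset.mem_sdiff.1 hcu).1
      · rwa [hLx x hxu] at this
    · by_cases hdf : R.faceOf d = f
      · rcases (hdarts d).1 hdf with h | ⟨h1, h2⟩ | ⟨h1, h2⟩
        · exact (hdX h).elim
        -- Since `u` is not on the boundary cycle, the face on the other side of `vu` is also in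
        -- `S`. It differs from `f`, so this edge is already checked in the smaller disc.
        · have hb : R.boundary S d = 0 := by
            rw [hD.boundary_eq]
            refine pathFlow_eq_zero_of_snd_notMem ?_
            rw [h2]
            simp only [List.take_succ_cons, List.take_zero, List.mem_append, List.mem_singleton,
              not_or]
            exact ⟨hul', huw.ne⟩
          have hs : R.faceOf d.symm ∈ S := (R.boundary_eq_zero_iff.1 hb).1 hd
          have hsf : R.faceOf d.symm ≠ f := by
            intro h
            have e1 : d.symm.fst = u := h2
            have e2 : d.symm.snd = v := h1
            rcases (hdarts _).1 h with ⟨h, -⟩ | ⟨h, -⟩ | ⟨-, h⟩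
            · exact huw.ne (e1.symm.trans h)
            · exact hvu.ne (h.symm.trans e1)
            · exact hadj.ne (h.symm.trans e2)
          have := (hgood d.symm (Finset.mem_erase.2 ⟨hsf, hs⟩)).symm
          rwa [Dart.symm_symm] at this
        · exact hgood_uw d h1 h2
      · exact hgood d (Finset.mem_erase.2 ⟨hdf, hd⟩)

/-- Thomassen's extension theorem for discs. -/
lemma edgeExtendable [Finite V] (hR : R.IsPlane) (outer : R.Face) (σ : G.Signature)
    (S : Finset R.Face) : R.EdgeExtendable outer σ S := by
  cases nonempty_fintype V
  have key : ∀ S : Finset R.Face, R.FanExtendable outer σ S := by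
    intro S
    induction S using Finset.strongInduction with
    | H S ih =>
      exact fanExtendable_of_ssubset hR
        (fun S' hS' => edgeExtendable_of_fanExtendable hR.1 (ih S' hS')) ih
  exact edgeExtendable_of_fanExtendable hR.1 (key S)

end RotationSystem

/-! ### From the outer cycle to a disc. -/

namespace SimpleGraph

variable {V : Type*} {G : SimpleGraph V}

lemma Walk.onPath_support_iff {u v : V} (p : G.Walk u v) (e : Sym2 V) :
    OnPath p.support e ↔ e ∈ p.edges := by
  induction p with
  | nil => simp
  | cons h p ih =>
    rw [Walk.support_cons, Walk.edges_cons, List.mem_cons, ← ih, ← p.cons_tail_support]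
    rfl

lemma Walk.exists_support_eq {u v : V} (p : G.Walk u v) (h : u ≠ v) :
    ∃ t, p.support = u :: (t ++ [v]) := by
  cases p with
  | nil => exact (h rfl).elim
  | cons hadj p =>
    refine ⟨p.support.dropLast, ?_⟩
    rw [Walk.support_cons]
    congr 1
    rw [← List.dropLast_append_getLast p.support_ne_nil]
    simp

end SimpleGraph

namespace RotationSystem

open SimpleGraph

variable {V : Type*} {G : SimpleGraph V} {R : RotationSystem G} {outer : R.Face}

/-- The boundary cycle of a face is, up to its direction, the boundary of the set of all other
faces. -/
lemma IsBoundaryCycle.boundary_eq_or [Fintype V] [Fintype R.Face] (hR : R.IsPlane) {v₁ v₂ : V}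
    {h₁₂ : G.Adj v₁ v₂} {P : G.Walk v₂ v₁} (hC : R.IsBoundaryCycle outer (Walk.cons h₁₂ P)) :
    (∀ d, R.boundary (Finset.univ.erase outer) d = pathFlow (v₁ :: P.support) d) ∨
      ∀ d, R.boundary (Finset.univ.erase outer) d = - pathFlow (v₁ :: P.support) d := by
  obtain ⟨hcyc, hedges⟩ := hC
  rw [Walk.cons_isCycle_iff] at hcyc
  obtain ⟨hpath, hnot⟩ := hcyc
  have hmem : ∀ d : G.Dart, R.faceOf d = outer → d.edge = s(v₁, v₂) ∨ d.edge ∈ P.edges := by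
    intro d hd
    have : d.edge ∈ R.faceEdges outer := ⟨d, hd, rfl⟩
    rw [hedges] at this
    simpa using this
  obtain ⟨t, ht⟩ := P.exists_support_eq h₁₂.ne.symm
  have hflow : ∀ d : G.Dart, pathFlow (v₁ :: P.support) d = unitFlow v₁ v₂ d + pathFlow P.support d := by
    intro d
    rw [ht, pathFlow_cons_cons]
  have hbal : IsBalanced (G := G) (pathFlow (v₁ :: P.support)) := by
    rw [ht]
    refine isBalanced_pathFlow_closed v₁ (v₂ :: t) ?_
    have := (Walk.cons h₁₂ P).isChain_adj_support
    rw [Walk.support_cons, ht] at this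
    simpa using this
  obtain ⟨h, hh⟩ := R.exists_jump_eq hR (fun d => (pathFlow (v₁ :: P.support) d : ℚ))
    (fun d => by rw [pathFlow_symm]; push_cast; rfl)
    (fun x => by have := hbal x; beta_reduce; exact_mod_cast this)
  set d₀ : G.Dart := ⟨(v₁, v₂), h₁₂⟩ with hd₀
  have hd₀e : d₀.edge = s(v₁, v₂) := rfl
  have hone : pathFlow (v₁ :: P.support) d₀ = 1 := by
    rw [hflow, unitFlow_self_eq_one d₀ rfl rfl]
    have : pathFlow P.support d₀ = 0 := by
      by_contra hne
      exact hnot ((P.onPath_support_iff _).1 (onPath_of_pathFlow_ne_zero hne))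
    rw [this, add_zero]
  -- The potential of the cycle jumps by one across `v₁v₂`, so this edge has different faces on its
  -- two sides, exactly one of them the outer face.
  have hfaces : R.faceOf d₀ ≠ R.faceOf d₀.symm := by
    intro he
    have := hh d₀
    rw [jump, he, hone] at this
    norm_num at this
  -- The difference vanishes on `v₁v₂` by the choice of `ε`, and off the cycle because the outer
  -- face touches no other edge. It is thus carried by the path `P`.
  have main : ∀ ε : ℤ, R.boundary (Finset.univ.erase outer) d₀ = ε →
      ∀ d, R.boundary (Finset.univ.erase outer) d - ε * pathFlow (v₁ :: P.support) d = 0 := by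
    intro ε hε
    have hysymm : ∀ d : G.Dart, R.boundary (Finset.univ.erase outer) d.symm
        - ε * pathFlow (v₁ :: P.support) d.symm
        = - (R.boundary (Finset.univ.erase outer) d - ε * pathFlow (v₁ :: P.support) d) := by
      intro d
      rw [boundary_symm, pathFlow_symm]
      ring
    refine eq_zero_of_support_onPath hysymm ?_ hpath.support_nodup fun d hd => ?_
    · intro x
      have e1 := R.isBalanced_jump
        (fun g => if g ∈ Finset.univ.erase outer then (1 : ℤ) else 0) x
      have e2 := congrArg (ε * ·) (hbal x)
      simp only [mul_zero] at e2
      rw [Finset.mul_sum] at e2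
      refine Eq.trans ?_ (sub_eq_zero.2 (e1.trans e2.symm))
      rw [← Finset.sum_sub_distrib]
      refine Finset.sum_congr rfl fun d _ => ?_
      split_ifs
      · rfl
      · simp
    · by_cases hde : d.edge = s(v₁, v₂)
      · rw [← hd₀e, dart_edge_eq_iff] at hde
        rcases hde with rfl | rfl
        · rw [hε, hone]; ring
        · rw [hysymm, hε, hone]; ring
      · have h0 : pathFlow (v₁ :: P.support) d = 0 := by
          rw [hflow]
          have e1 : unitFlow v₁ v₂ d = 0 := by
            by_contra hne
            exact hde (edge_eq_of_unitFlow_ne_zero hne)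
          have e2 : pathFlow P.support d = 0 := by
            by_contra hne
            exact hd (onPath_of_pathFlow_ne_zero hne)
          rw [e1, e2, add_zero]
        have hne : ∀ e : G.Dart, e.edge = d.edge → R.faceOf e ≠ outer := by
          intro e he hout
          have := hmem e hout
          rw [he, ← P.onPath_support_iff] at this
          tauto
        rw [h0, mul_zero, sub_zero, boundary_eq_zero_iff]
        simp [hne d rfl, hne d.symm (Dart.edge_symm d)]
  have hex : s(v₁, v₂) ∈ R.faceEdges outer := by
    rw [hedges]
    simp
  obtain ⟨d, hd, hde⟩ := hex
  change R.faceOf d = outer at hd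
  rw [← hd₀e, dart_edge_eq_iff] at hde
  rcases hde with rfl | rfl
  · right
    intro d'
    have hb : R.boundary (Finset.univ.erase outer) d₀.symm = 1 := by
      rw [boundary_eq_one_iff, Dart.symm_symm, hd]
      rw [hd] at hfaces
      simp [hfaces.symm]
    rw [boundary_symm] at hb
    have := main (-1) (by omega) d'
    omega
  · left
    intro d'
    have hb : R.boundary (Finset.univ.erase outer) d₀ = 1 := by
      rw [boundary_eq_one_iff, hd]
      rw [hd] at hfaces
      simp [hfaces]
    have := main 1 hb d'
    omega

/-- The bounded faces of a near-triangulation form a disc. -/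
lemma IsNearTriangulation.isDisc_or [Fintype V] [Fintype R.Face]
    (hG : R.IsNearTriangulation outer) {v₁ v₂ : V} {h₁₂ : G.Adj v₁ v₂} {P : G.Walk v₂ v₁}
    (hC : R.IsBoundaryCycle outer (Walk.cons h₁₂ P)) {t : List V}
    (ht : P.support = v₂ :: (t ++ [v₁])) :
    R.IsDisc outer (v₁ :: v₂ :: t) (Finset.univ.erase outer) ∨
      R.IsDisc outer (v₂ :: v₁ :: t.reverse) (Finset.univ.erase outer) := by
  have hnd := ((Walk.cons_isCycle_iff _ _).1 hC.1).1.support_nodup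
  have htri : ∀ f ∈ Finset.univ.erase outer, R.IsTriangle f := fun f hf =>
    hG.triangle f (Finset.ne_of_mem_erase hf)
  rw [ht] at hnd
  rcases hC.boundary_eq_or hG.plane with h | h
  · left
    rw [ht] at h
    refine ⟨?_, by simp, ?_, htri, by simp, fun d => by rw [h]; simp⟩
    · rw [← List.cons_append, List.nodup_append_comm] at hnd
      exact hnd
    · have := (Walk.cons h₁₂ P).isChain_adj_support
      rw [Walk.support_cons, ht] at this
      simpa using this
  · right
    rw [ht] at h
    have hrev : v₁ :: (t.reverse ++ [v₂]) = (v₂ :: (t ++ [v₁])).reverse := by simp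
    have hl : v₂ :: v₁ :: t.reverse ++ (v₂ :: v₁ :: t.reverse).take 1
        = v₂ :: (v₂ :: (t ++ [v₁])).reverse := by simp
    refine ⟨?_, by simp, ?_, htri, by simp, fun d => ?_⟩
    · have : (v₂ :: v₁ :: t.reverse).Perm (v₂ :: (t ++ [v₁])) := by
        refine List.Perm.cons _ ?_
        have e : v₁ :: t.reverse = (t ++ [v₁]).reverse := by simp
        rw [e]
        exact List.reverse_perm _
      exact this.nodup_iff.2 hnd
    · have := (Walk.cons h₁₂.symm P.reverse).isChain_adj_support
      rw [Walk.support_cons, Walk.support_reverse, ht] at this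
      rwa [hl]
    · rw [h, hl, ← hrev, pathFlow_cons_cons, pathFlow_cons_cons, hrev, pathFlow_reverse,
        unitFlow_swap v₁ v₂]
      ring

end RotationSystem

end PlaneDiscs

/-! ### The extension theorem for near-triangulations. -/

theorem mainTheorem1 {V : Type*} [Finite V] (G : SimpleGraph V) (σ : G.Signature)
    (R : RotationSystem G) (outer : R.Face) (hG : R.IsNearTriangulation outer)
    -- the outer cycle `C = v₁ v₂ ⋯ vₚ v₁`, with first edge `v₁v₂` and remaining path `P`
    (v₁ v₂ : V) (h₁₂ : G.Adj v₁ v₂) (P : G.Walk v₂ v₁)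
    (hC : R.IsBoundaryCycle outer (SimpleGraph.Walk.cons h₁₂ P))
    (L : V → Finset ℤ) (c₁ c₂ : ℤ) (hc₁ : c₁ ∈ L v₁) (hc₂ : c₂ ∈ L v₂)
    (hpre : c₁ ≠ σ.sign h₁₂ * c₂)
    (hboundary : ∀ v ∈ (SimpleGraph.Walk.cons h₁₂ P).support,
      v ≠ v₁ → v ≠ v₂ → 3 ≤ (L v).card)
    (hinterior : ∀ v, v ∉ (SimpleGraph.Walk.cons h₁₂ P).support → 5 ≤ (L v).card) :
    ∃ c : V → ℤ, σ.IsListColoring L c ∧ c v₁ = c₁ ∧ c v₂ = c₂ := by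
  classical
  cases nonempty_fintype V
  have : Fintype R.Face := Fintype.ofFinite _
  obtain ⟨t, ht⟩ := P.exists_support_eq h₁₂.ne.symm
  have hsupp : ∀ x, x ∈ (SimpleGraph.Walk.cons h₁₂ P).support ↔ x = v₁ ∨ x = v₂ ∨ x ∈ t := by
    intro x
    rw [SimpleGraph.Walk.support_cons, ht]
    simp only [List.mem_cons, List.mem_append, List.not_mem_nil, or_false]
    tauto
  have hnd := ((SimpleGraph.Walk.cons_isCycle_iff _ _).1 hC.1).1.support_nodup
  rw [ht] at hnd
  simp only [List.nodup_cons, List.nodup_append, List.mem_append, List.mem_singleton,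
    not_or] at hnd
  obtain ⟨⟨hv₂t, hv₂₁⟩, -, -, hv₁t⟩ := hnd
  -- The precoloring is encoded by one-element lists.
  set L' := Function.update (Function.update L v₁ {c₁}) v₂ {c₂} with hL'
  have hL₁ : L' v₁ = {c₁} := by simp [hL', h₁₂.ne]
  have hL₂ : L' v₂ = {c₂} := by simp [hL']
  have hLx : ∀ x, x ≠ v₁ → x ≠ v₂ → L' x = L x := fun x h1 h2 => by
    rw [hL', Function.update_of_ne h2, Function.update_of_ne h1]
  have h3 : ∀ x ∈ t, 3 ≤ (L' x).card := by
    intro x hx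
    have h1 : x ≠ v₁ := hv₁t x hx v₁ rfl
    have h2 : x ≠ v₂ := ne_of_mem_of_not_mem hx hv₂t
    rw [hLx x h1 h2]
    exact hboundary x ((hsupp x).2 (Or.inr (Or.inr hx))) h1 h2
  have h5 : ∀ x, ¬ (x = v₁ ∨ x = v₂ ∨ x ∈ t) → 5 ≤ (L' x).card := by
    intro x hx
    rw [hLx x (fun h => hx (Or.inl h)) (fun h => hx (Or.inr (Or.inl h)))]
    exact hinterior x fun h => hx ((hsupp x).1 h)
  obtain ⟨l, hl, c, hcL, hcg⟩ : ∃ l : List V, (∀ x, x ∈ l ↔ x = v₁ ∨ x = v₂ ∨ x ∈ t) ∧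
      ∃ c, R.ColorsDisc σ L' l (Finset.univ.erase outer) ∅ c := by
    rcases hG.isDisc_or hC ht with hD | hD
    · have hl : ∀ x, x ∈ v₁ :: v₂ :: t ↔ x = v₁ ∨ x = v₂ ∨ x ∈ t := by simp
      exact ⟨_, hl, RotationSystem.edgeExtendable hG.plane outer σ _ v₁ v₂ t L' c₁ c₂ hD hL₁ hL₂
        (fun _ => hpre) h3 fun d _ hd => h5 _ ((hl _).not.1 hd)⟩
    · have hl : ∀ x, x ∈ v₂ :: v₁ :: t.reverse ↔ x = v₁ ∨ x = v₂ ∨ x ∈ t := by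
        intro x
        simp only [List.mem_cons, List.mem_reverse]
        tauto
      exact ⟨_, hl, RotationSystem.edgeExtendable hG.plane outer σ _ v₂ v₁ t.reverse L' c₂ c₁ hD
        hL₂ hL₁ (fun _ => σ.ne_sign_mul_comm h₁₂ hpre) (fun x hx => h3 x (List.mem_reverse.1 hx))
        fun d _ hd => h5 _ ((hl _).not.1 hd)⟩
  -- If both sides of an edge were outer, the boundary chain would vanish on an edge of the cycle,
  -- where the flow is nonzero. Thus every edge has a dart on a bounded face, at which the disc
  -- coloring checks it.
  have hboth : ∀ d : G.Dart, R.faceOf d = outer → R.faceOf d.symm ≠ outer := by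
    intro d hd hds
    have hmem : d.edge ∈ R.faceEdges outer := ⟨d, hd, rfl⟩
    rw [hC.2] at hmem
    have hzero : R.boundary (Finset.univ.erase outer) d = 0 := by
      rw [R.boundary_eq_zero_iff, hd, hds]
    have hflow : SimpleGraph.pathFlow (v₁ :: P.support) d = 0 := by
      rcases hC.boundary_eq_or hG.plane with h | h <;> have := h d <;> omega
    have hcyc := (SimpleGraph.Walk.cons_isCycle_iff _ _).1 hC.1
    have hmem' : d.edge = s(v₁, v₂) ∨ d.edge ∈ P.edges := by simpa using hmem
    have hsum : SimpleGraph.pathFlow (v₁ :: P.support) d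
        = SimpleGraph.unitFlow v₁ v₂ d + SimpleGraph.pathFlow P.support d := by
      rw [ht, SimpleGraph.pathFlow_cons_cons]
    rw [hsum] at hflow
    rcases hmem' with h | h
    · have h0 : SimpleGraph.pathFlow P.support d = 0 := by
        by_contra hne
        refine hcyc.2 ?_
        rw [← h, ← P.onPath_support_iff]
        exact SimpleGraph.onPath_of_pathFlow_ne_zero hne
      have := SimpleGraph.unitFlow_ne_zero h
      omega
    · have h0 : SimpleGraph.unitFlow v₁ v₂ d = 0 := by
        by_contra hne
        refine hcyc.2 ?_
        rwa [← SimpleGraph.edge_eq_of_unitFlow_ne_zero hne]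
      have := SimpleGraph.pathFlow_ne_zero hcyc.1.support_nodup ((P.onPath_support_iff _).2 h)
      omega
  have hc1 : c v₁ = c₁ := by
    have := hcL v₁ (Or.inl ((hl v₁).2 (Or.inl rfl)))
    rwa [hL₁, Finset.mem_singleton] at this
  have hc2 : c v₂ = c₂ := by
    have := hcL v₂ (Or.inl ((hl v₂).2 (Or.inr (Or.inl rfl))))
    rwa [hL₂, Finset.mem_singleton] at this
  refine ⟨c, ⟨fun u v huv => ?_, fun x => ?_⟩, hc1, hc2⟩
  · by_cases ho : R.faceOf ⟨(u, v), huv⟩ = outer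
    · have := (hcg (SimpleGraph.Dart.symm ⟨(u, v), huv⟩)
        (Finset.mem_erase.2 ⟨hboth _ ho, Finset.mem_univ _⟩) (by simp)).symm
      exact this
    · exact hcg ⟨(u, v), huv⟩ (Finset.mem_erase.2 ⟨ho, Finset.mem_univ _⟩) (by simp)
  · by_cases h1 : x = v₁
    · rw [h1, hc1]; exact hc₁
    by_cases h2 : x = v₂
    · rw [h2, hc2]; exact hc₂
    rw [← hLx x h1 h2]
    have : Nontrivial V := ⟨v₁, v₂, h₁₂.ne⟩
    -- Every vertex has an incident edge, and hence lies on a bounded face by `hboth`; this places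
    -- it in the disc.
    obtain ⟨y, hxy⟩ := hG.plane.1.preconnected.exists_adj_of_nontrivial x
    by_cases ho : R.faceOf ⟨(x, y), hxy⟩ = outer
    · refine hcL x (Or.inr ⟨R.faceStep (SimpleGraph.Dart.symm ⟨(x, y), hxy⟩),
        R.faceStep_fst _, ?_⟩)
      rw [RotationSystem.faceOf_faceStep]
      exact Finset.mem_erase.2 ⟨hboth _ ho, Finset.mem_univ _⟩
    · exact hcL x (Or.inr ⟨⟨(x, y), hxy⟩, rfl, Finset.mem_erase.2 ⟨ho, Finset.mem_univ _⟩⟩)
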